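/- **Setting.** Let $\mathsf X\subset\mathbb R^n$ be compact, $\mathcal S_\Theta=\{\theta^1,\dots,\theta^K\}$ finite with true parameter $\theta^*\in\mathcal S_\Theta$, and $\mathsf W$ a measurable space. Let $p(dx'\mid\theta,x,w)$ be the state transition (a Markov kernel on $\mathsf X$), $p(dw'\mid w,y)$ the transition of the external input (a Markov kernel on $\mathsf W$, $y\in\mathbb R^n$ being the released data), $r(\theta,x,x',y)$ and $d(x,y)$ real costs, and $\rho,\lambda,\hat D\in\mathbb R$. A belief is a probability measure $\beta$ on $\mathcal S_\Theta\times\mathsf X$; beliefs carry the weak topology. At time $t$ the admissible policies have densities $k_t(y\mid\theta,x,\beta;u)$, $u\in\mathcal U_t\subset\mathbb R^{d_u}$. Write $q(\theta)=\beta(\{\theta\}\times\mathsf X)$, $b(dx\mid\theta)$ for the conditional law of the state, $f(y\mid\theta)=\int k_t(y\mid\theta,x,\beta;u)\,b(dx\mid\theta)$ and $p_Y(y;\beta,u)=\sum_\theta q(\theta)f(y\mid\theta)$. The stage cost at external input $w$ is $$C_t(w,\beta,u)=\rho\sum_\theta q(\theta)\int f(y\mid\theta)\log\frac{f(y\mid\theta)}{p_Y(y;\beta,u)}\,dy+\iiint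 r(\theta^*,x,x',y)\,p(dx'\mid\theta^*,x,w)\,k_t(y\mid\theta^*,x,\beta;u)\,dy\,\beta(\{\theta^*\}\times dx)+\lambda\Big(\iint d(x,y)k_t(y\mid\theta,x,\beta;u)\,dy\,\beta(d\theta,dx)-\hat D\Big).$$ The belief update $\Phi_t(w,\beta,u,y)$ is the probability measure proportional to $\int p(dx'\mid\theta,x,w)\,k_t(y\mid\theta,x,\beta;u)\,\beta(\{\theta\}\times dx)$. The optimal values with horizon $T$ are $V^*_{T+1}=0$ and $$V_t^*(w,\beta)=\inf_{u\in\mathcal U_t}\Big\{C_t(w,\beta,u)+\int p_Y(y;\beta,u)\int V^*_{t+1}\big(w',\Phi_t(w,\beta,u,y)\big)\,p(dw'\mid w,y)\,dy\Big\}.$$ **Particle filter.** A particle belief is a system $\hat\beta=\sum_{i=1}^N\omega_i\delta_{(\theta_i,x_i)}$ with normalized weights $\omega_i\ge0$. After the release of $y$ under the parameter $u$, the weights are updated by $\tilde\omega_i\propto\omega_i k_t(y\mid\theta_i,x_i,\hat\beta;u)$. If a measurable degeneracy score of $\tilde\omega$ is below a threshold, the system is resampled: slot $j$ independently receives a copy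 of particle $i$ with probability $R_{ji}(\tilde\omega)$, where $R$ is measurable and conditionally unbiased ($\sum_jR_{ji}(\tilde\omega)=N\tilde\omega_i$; e.g. multinomial resampling), and the weights are reset to $1/N$. Then each particle keeps its parameter and its state moves independently according to $p(\cdot\mid\theta_i,x_i,w)$. The particle values are $V^{*,(N)}_{T+1}=0$ and $$V_t^{*,(N)}(w,\hat\beta)=\inf_{u\in\mathcal U_t}\Big\{C_t(w,\hat\beta,u)+\mathbb E\big[V^{*,(N)}_{t+1}(W_{t+1},\hat\beta_{t+1})\big]\Big\},$$ where $Y_t$ has density $p_Y(\cdot\,;\hat\beta,u)$, $W_{t+1}\sim p(\cdot\mid w,Y_t)$, and $\hat\beta_{t+1}$ is the next system produced by the filter from $\hat\beta$, $w$, $u$, $Y_t$ (independent of $W_{t+1}$ given $Y_t$). It is understood that these expectations exist, i.e. that $V^{*,(N)}_{s+1}$ is integrable with respect to the law of $(W_{s+1},\hat\beta_{s+1})$, for all $s\in\{t,\dots,T\}$, $N\ge1$, $w$, $\hat\beta$ and $u$, where $t$ is the time in the theorem. **Assumptions.** For each time $t$: 1. $\mathcal U_t$ is compact and nonempty; $k_t(\cdot\mid\theta,x,\beta;u)$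 is a strictly positive probability density on $\mathbb R^n$, and $(x,\beta)\mapsto k_t(y\mid\theta,x,\beta;u)$ is continuous for all $(\theta,y,u)$. 2. There are measurable $\underline k_t,\overline k_t:\mathbb R^n\to(0,\infty)$ with $\underline k_t(y)\le k_t(y\mid\theta,x,\beta;u)\le\overline k_t(y)$ for all arguments, and $\int\overline k_t\,dy$, $\int\overline k_t(1+|\log\underline k_t|+|\log\overline k_t|)\,dy$ and $\int(1+\|y\|)\overline k_t\,dy$ are finite. 3. There is $L_k<\infty$ with $|k_t(y\mid\theta,x,\beta;u)-k_t(y\mid\theta,x,\beta;v)|\le L_k\|u-v\|\,\overline k_t(y)$ for all arguments. 4. $r$ is continuous and bounded; $d$ is continuous and there is a function $D$ with $|d(x,y)|\le D(y)$ for all $x,y$ and $D\,\overline k_t$ integrable (e.g. $d$ grows at most linearly in $y$). 5. The transition is Feller: for all $\theta$, $w$ and bounded continuous $g$, $x\mapsto\int g(x')\,p(dx'\mid\theta,x,w)$ is continuous. **Theorem (asymptotic convergence of the Bellman equation).** Let $1\le t\le T$, let $\beta_1$ be an initial belief, and fix a history of external inputs $w_1,\dots,w_t$, released data $y_1,\dots,y_{t-1}$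 and policy parameters $u_s\in\mathcal U_s$, $s<t$. Let $\beta_{s+1}=\Phi_s(w_s,\beta_s,u_s,y_s)$ be the exact beliefs along this history. For each $N\ge1$ let $\hat\beta^{(N)}_t$ be the particle belief at time $t$ produced along the same history by the particle filter started from $N$ independent draws from $\beta_1$ with weights $1/N$; the filters for different $N$ are defined on one probability space, with an arbitrary joint law. Then $$\lim_{N\to\infty}V_t^{*,(N)}\big(w_t,\hat\beta^{(N)}_t\big)=V_t^*(w_t,\beta_t)\qquad\text{almost surely.}$$ -/

import Mathlib

open MeasureTheory ProbabilityTheory Filter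
open scoped Topology ENNReal

noncomputable section

namespace ParticleBelief

/-- Beliefs: probability measures on (parameter, state), with the topology of weak convergence.
The parameter takes the `K` values `θ¹, …, θᴷ`, which are represented by their indices. -/
abbrev Belief {n : ℕ} (K : ℕ) (X : Set (EuclideanSpace ℝ (Fin n))) : Type :=
  ProbabilityMeasure (Fin K × X)

/-- The data of the data-sharing problem. State space `X ⊆ ℝⁿ`, released data in `ℝⁿ`, external
input in `W`, decision variables in `ℝᵈ`. The policy densities and decision sets are indexed by
time. -/
structure Model (n K d : ℕ) (X : Set (EuclideanSpace ℝ (Fin n))) (W : Type*)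
    [MeasurableSpace W] where
  /-- the state space is compact -/
  isCompact_X : IsCompact X
  /-- the state transition `p(dx' ∣ θ, x, w)` -/
  trans : Kernel (Fin K × X × W) X
  trans_markov : IsMarkovKernel trans
  /-- the transition `p(dw' ∣ w, y)` of the external input -/
  ext : Kernel (W × EuclideanSpace ℝ (Fin n)) W
  ext_markov : IsMarkovKernel ext
  /-- the set of decision variables at time `t` -/
  U : ℕ → Set (EuclideanSpace ℝ (Fin d))
  /-- `k t y θ x β u` is the density `k_t(y ∣ θ, x, β; u)` of the admissible policy -/
  k : (t : ℕ) → EuclideanSpace ℝ (Fin n) → Fin K → X → Belief K X → U t → ℝ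
  k_pos : ∀ t y θ x β u, 0 < k t y θ x β u
  k_measurable : ∀ t θ x β u, Measurable fun y => k t y θ x β u
  k_lintegral : ∀ t θ x β u, ∫⁻ y, ENNReal.ofReal (k t y θ x β u) = 1
  /-- the policy density is continuous in the state and the belief -/
  k_continuous : ∀ t y θ u, Continuous fun q : X × Belief K X => k t y θ q.1 q.2 u
  /-- the true parameter `θ*` -/
  θstar : Fin K
  /-- the system cost `r(θ, x, x', y)` -/
  r : Fin K → X → X → EuclideanSpace ℝ (Fin n) → ℝ
  /-- the distortion `d(x, y)` -/
  dist : X → EuclideanSpace ℝ (Fin n) → ℝ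
  /-- the distortion budget -/
  Dhat : ℝ
  /-- the privacy weight -/
  ρ : ℝ
  /-- the Lagrange multiplier of the distortion constraint -/
  lam : ℝ

namespace Model

variable {n K d : ℕ} {X : Set (EuclideanSpace ℝ (Fin n))} {W : Type*} [MeasurableSpace W]
  (M : Model n K d X W)

/-- The regularity conditions on envelopes, decision variables, costs and transition. -/
structure Regular (kLow kUp : ℕ → EuclideanSpace ℝ (Fin n) → ℝ) : Prop where
  U_compact : ∀ t, IsCompact (M.U t)
  U_nonempty : ∀ t, (M.U t).Nonempty
  kLow_measurable : ∀ t, Measurable (kLow t)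
  kUp_measurable : ∀ t, Measurable (kUp t)
  kLow_pos : ∀ t y, 0 < kLow t y
  kLow_le : ∀ t y θ x β u, kLow t y ≤ M.k t y θ x β u
  le_kUp : ∀ t y θ x β u, M.k t y θ x β u ≤ kUp t y
  integrable_kUp : ∀ t, Integrable (kUp t)
  integrable_log : ∀ t, Integrable fun y =>
    kUp t y * (1 + |Real.log (kLow t y)| + |Real.log (kUp t y)|)
  integrable_norm : ∀ t, Integrable fun y => (1 + ‖y‖) * kUp t y
  lipschitz : ∀ t, ∃ L : ℝ, ∀ (u v : M.U t) θ x β y,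
    |M.k t y θ x β u - M.k t y θ x β v| ≤ L * ‖(u : EuclideanSpace ℝ (Fin d)) - v‖ * kUp t y
  r_continuous : Continuous fun q : Fin K × X × X × EuclideanSpace ℝ (Fin n) =>
    M.r q.1 q.2.1 q.2.2.1 q.2.2.2
  r_bounded : ∃ B : ℝ, ∀ θ x x' y, |M.r θ x x' y| ≤ B
  dist_continuous : Continuous fun q : X × EuclideanSpace ℝ (Fin n) => M.dist q.1 q.2
  /-- the distortion is integrable against the upper envelope, uniformly in the state (for
  instance, it grows at most linearly in `y`) -/
  dist_integrable : ∀ t, ∃ D : EuclideanSpace ℝ (Fin n) → ℝ,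
    (∀ x y, |M.dist x y| ≤ D y) ∧ Integrable fun y => D y * kUp t y
  feller : ∀ (θ : Fin K) (w : W) (g : BoundedContinuousFunction X ℝ),
    Continuous fun x : X => ∫ x', g x' ∂(M.trans (θ, x, w))

/-! ### Stage cost -/

/-- Marginal mass `q(θ)` of a belief. -/
def marg (β : Belief K X) (θ : Fin K) : ℝ := (β : Measure (Fin K × X)).real {p | p.1 = θ}

/-- The density `f(y ∣ θ) = ∫ k_t(y ∣ θ, x, β; u) b(dx ∣ θ)`, where `b(dx ∣ θ)` is the conditional
law of the state under `β` (and `f = 0` if `θ` has no mass). -/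
def condDensity (t : ℕ) (β : Belief K X) (u : M.U t) (θ : Fin K)
    (y : EuclideanSpace ℝ (Fin n)) : ℝ :=
  (marg β θ)⁻¹ * ∫ p in {p : Fin K × X | p.1 = θ}, M.k t y θ p.2 β u ∂(β : Measure (Fin K × X))

/-- The marginal density `p_Y(y) = ∑ θ, q(θ) f(y ∣ θ)` of the released data. -/
def density (t : ℕ) (β : Belief K X) (u : M.U t) (y : EuclideanSpace ℝ (Fin n)) : ℝ :=
  ∑ θ, marg β θ * M.condDensity t β u θ y

/-- The mutual information between the parameter and the released data. -/
def mutualInfo (t : ℕ) (β : Belief K X) (u : M.U t) : ℝ :=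
  ∑ θ, marg β θ * ∫ y, M.condDensity t β u θ y *
    Real.log (M.condDensity t β u θ y / M.density t β u y)

/-- The system cost
`∭ r(θ*, x, x', y) p(dx' ∣ θ*, x, w) k_t(y ∣ θ*, x, β; u) dy β({θ*} × dx)`. -/
def systemCost (t : ℕ) (w : W) (β : Belief K X) (u : M.U t) : ℝ :=
  ∫ p in {p : Fin K × X | p.1 = M.θstar},
    (∫ y, (∫ x', M.r M.θstar p.2 x' y ∂(M.trans (M.θstar, p.2, w))) *
      M.k t y M.θstar p.2 β u) ∂(β : Measure (Fin K × X))

/-- The expected distortion. -/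
def distortion (t : ℕ) (β : Belief K X) (u : M.U t) : ℝ :=
  ∫ p, (∫ y, M.dist p.2 y * M.k t y p.1 p.2 β u) ∂(β : Measure (Fin K × X))

/-- The stage cost `C_t(β, u)`, given the current external input `w`. -/
def stageCost (t : ℕ) (w : W) (β : Belief K X) (u : M.U t) : ℝ :=
  M.ρ * M.mutualInfo t β u + M.systemCost t w β u + M.lam * (M.distortion t β u - M.Dhat)

/-! ### Belief update and the belief Markov decision process -/

/-- Propagation of a (parameter, state) pair: the parameter is kept, the state moves. -/
def move (w : W) : Kernel (Fin K × X) (Fin K × X) :=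
  (Kernel.deterministic Prod.fst measurable_fst) ×ₖ
    (M.trans.comap (fun p => (p.1, p.2, w)) (by fun_prop))

instance (w : W) : IsMarkovKernel (M.move w) := by
  have := M.trans_markov
  unfold move
  infer_instance

/-- The likelihood of the released data `y` at a (parameter, state) pair. -/
def likelihood (t : ℕ) (β : Belief K X) (u : M.U t) (y : EuclideanSpace ℝ (Fin n))
    (p : Fin K × X) : ℝ≥0∞ :=
  ENNReal.ofReal (M.k t y p.1 p.2 β u)

/-- Bayes' rule: the posterior of (parameter, current state) after the release of `y`. -/
def posterior (t : ℕ) (β : Belief K X) (u : M.U t) (y : EuclideanSpace ℝ (Fin n)) :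
    Measure (Fin K × X) :=
  (∫⁻ p, M.likelihood t β u y p ∂(β : Measure (Fin K × X)))⁻¹ •
    (β : Measure (Fin K × X)).withDensity (M.likelihood t β u y)

lemma continuous_density (t : ℕ) (β : Belief K X) (u : M.U t)
    (y : EuclideanSpace ℝ (Fin n)) :
    Continuous fun p : Fin K × X => M.k t y p.1 p.2 β u := by
  rw [continuous_prod_of_discrete_left]
  intro θ
  exact (M.k_continuous t y θ u).comp (by fun_prop : Continuous fun x : X => (x, β))

instance (t : ℕ) (β : Belief K X) (u : M.U t) (y : EuclideanSpace ℝ (Fin n)) :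
    IsProbabilityMeasure (M.posterior t β u y) := by
  have hc := M.continuous_density t β u y
  have hX : CompactSpace X := isCompact_iff_compactSpace.mp M.isCompact_X
  have hm : Measurable (M.likelihood t β u y) := hc.measurable.ennreal_ofReal
  have h0 : ∫⁻ p, M.likelihood t β u y p ∂(β : Measure (Fin K × X)) ≠ 0 := by
    rw [Ne, lintegral_eq_zero_iff hm]
    intro h
    obtain ⟨p, hp⟩ := h.exists
    exact absurd hp (by simpa [likelihood] using M.k_pos t y p.1 p.2 β u)
  have h1 : ∫⁻ p, M.likelihood t β u y p ∂(β : Measure (Fin K × X)) ≠ ∞ := by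
    obtain ⟨B, hB⟩ := (isCompact_range hc).bddAbove
    refine ne_top_of_le_ne_top (b := ENNReal.ofReal B) ENNReal.ofReal_ne_top ?_
    calc _ ≤ ∫⁻ _, ENNReal.ofReal B ∂(β : Measure (Fin K × X)) :=
          lintegral_mono fun p => ENNReal.ofReal_le_ofReal (hB ⟨p, rfl⟩)
      _ = _ := by simp
  constructor
  rw [posterior, Measure.smul_apply, withDensity_apply _ MeasurableSet.univ,
    Measure.restrict_univ, smul_eq_mul, ENNReal.inv_mul_cancel h0 h1]

/-- The belief update `Φ`:
`β'(θ, dx') ∝ ∫ p(dx' ∣ θ, x, w) k_t(y ∣ θ, x, β; u) β(θ, dx)`. -/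
def update (t : ℕ) (w : W) (β : Belief K X) (u : M.U t) (y : EuclideanSpace ℝ (Fin n)) :
    Belief K X :=
  ⟨(M.posterior t β u y).bind (M.move w), inferInstance⟩

/-- Backward induction for the belief Markov decision process, with `m` stages to go from time
`t`. The expectation is over `Y_t` and `W_{t+1}`. -/
def valueToGo : (m t : ℕ) → W → Belief K X → ℝ
  | 0, _, _, _ => 0
  | m + 1, t, w, β => ⨅ u : M.U t, (M.stageCost t w β u +
      ∫ y, M.density t β u y *
        ∫ w', valueToGo m (t + 1) w' (M.update t w β u y) ∂(M.ext (w, y)))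

/-- The optimal value `V_t^*(β)` with horizon `T` (and `V_{T+1}^* = 0`), given the current
external input `w`. -/
def value (T t : ℕ) (w : W) (β : Belief K X) : ℝ := M.valueToGo (T + 1 - t) t w β

/-- The belief `β_t` along a history of external inputs, policy parameters and released data,
started from `β₁` at time `1` (the entry at time `0` is not used). -/
def beliefAt (β₁ : Belief K X) (w : ℕ → W) (u : (s : ℕ) → M.U s)
    (y : ℕ → EuclideanSpace ℝ (Fin n)) : ℕ → Belief K X
  | 0 => β₁
  | 1 => β₁
  | s + 2 => M.update (s + 1) (w (s + 1)) (beliefAt β₁ w u y (s + 1)) (u (s + 1)) (y (s + 1))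

end Model

/-! ### Particle systems -/

/-- A system of `N` particles `(θ_i, x_i)` with normalized nonnegative weights. -/
abbrev Particles {n : ℕ} (K : ℕ) (X : Set (EuclideanSpace ℝ (Fin n))) (N : ℕ) : Type :=
  (Fin N → Fin K × X) × stdSimplex ℝ (Fin N)

/-- The weighted measure `∑ i, ω_i δ_{z_i}`. -/
def weighted {α : Type*} [MeasurableSpace α] {N : ℕ} (ω : stdSimplex ℝ (Fin N))
    (μ : Fin N → Measure α) : Measure α :=
  ∑ i, ENNReal.ofReal (ω.1 i) • μ i

instance {α : Type*} [MeasurableSpace α] {N : ℕ} (ω : stdSimplex ℝ (Fin N))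
    (μ : Fin N → Measure α) [∀ i, IsProbabilityMeasure (μ i)] :
    IsProbabilityMeasure (weighted ω μ) := by
  constructor
  simp only [weighted, Measure.coe_finsetSum, Finset.sum_apply, Measure.smul_apply,
    measure_univ, smul_eq_mul, mul_one]
  rw [← ENNReal.ofReal_sum_of_nonneg fun i _ => ω.2.1 i, ω.2.2, ENNReal.ofReal_one]

/-- The particle belief `∑ i, ω_i δ_{(θ_i, x_i)}`. -/
def particleBelief {n K : ℕ} {X : Set (EuclideanSpace ℝ (Fin n))} {N : ℕ}
    (z : Particles K X N) : Belief K X :=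
  ⟨weighted z.2 fun i => Measure.dirac (z.1 i), inferInstance⟩

/-- The uniform weights `1 / N`. -/
def uniformWeights (N : ℕ) [NeZero N] : stdSimplex ℝ (Fin N) :=
  ⟨fun _ => (N : ℝ)⁻¹, fun _ => by positivity, by simp⟩

/-- An adaptive resampling rule for `N` particles. Resampling takes place when the score of the
updated weights `ω` is below the threshold. Then slot `j` of the new system receives a copy of
particle `i` with probability `draw ω j i`, independently for the different slots; conditionally
on the weights, the expected number of copies of particle `i` is `N ω_i`. -/
structure Resampling (N : ℕ) where
  score : stdSimplex ℝ (Fin N) → ℝ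
  score_measurable : Measurable score
  threshold : ℝ
  draw : stdSimplex ℝ (Fin N) → Fin N → stdSimplex ℝ (Fin N)
  draw_measurable : ∀ j, Measurable fun ω => draw ω j
  unbiased : ∀ ω i, ∑ j, (draw ω j).1 i = N * ω.1 i

namespace Model

variable {n K d : ℕ} {X : Set (EuclideanSpace ℝ (Fin n))} {W : Type*} [MeasurableSpace W]
  (M : Model n K d X W) {N : ℕ}

/-- The weight update `ω_i' ∝ ω_i k_t(y ∣ θ_i, x_i, β̂; u)`. -/
def reweight (t : ℕ) (z : Particles K X N) (u : M.U t) (y : EuclideanSpace ℝ (Fin n)) :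
    stdSimplex ℝ (Fin N) :=
  ⟨fun i => z.2.1 i * M.k t y (z.1 i).1 (z.1 i).2 (particleBelief z) u /
      ∑ j, z.2.1 j * M.k t y (z.1 j).1 (z.1 j).2 (particleBelief z) u, by
    have h0 : ∀ j, 0 ≤ z.2.1 j * M.k t y (z.1 j).1 (z.1 j).2 (particleBelief z) u := fun j =>
      mul_nonneg (z.2.2.1 j) (M.k_pos _ _ _ _ _ _).le
    have h1 : ∑ j, z.2.1 j * M.k t y (z.1 j).1 (z.1 j).2 (particleBelief z) u ≠ 0 := by
      intro h
      rw [Finset.sum_eq_zero_iff_of_nonneg fun j _ => h0 j] at h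
      have h2 : ∀ j, z.2.1 j = 0 := fun j =>
        (mul_eq_zero.mp (h j (Finset.mem_univ j))).resolve_right (M.k_pos _ _ _ _ _ _).ne'
      have h3 := z.2.2.2
      simp [h2] at h3
    exact ⟨fun i => div_nonneg (h0 i) (Finset.sum_nonneg fun j _ => h0 j), by
      rw [← Finset.sum_div, div_self h1]⟩⟩

open Classical in
/-- One step of the particle filter after the release of `y`: update the weights, resample if the
resampling rule says so (the weights are then reset to `1 / N`), and move every particle
independently by the state transition. The result is the law of the next particle system. -/
def filterStep [NeZero N] (R : Resampling N) (t : ℕ) (w : W) (z : Particles K X N) (u : M.U t)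
    (y : EuclideanSpace ℝ (Fin n)) : Measure (Particles K X N) :=
  let ω := M.reweight t z u y
  if R.score ω < R.threshold then
    (Measure.pi fun j => weighted (R.draw ω j) fun i => M.move w (z.1 i)).map
      fun x => (x, uniformWeights N)
  else
    (Measure.pi fun i => M.move w (z.1 i)).map fun x => (x, ω)

/-- The law of `(W_{t+1}, next particle system)` given the current external input, particle system
and decision variable, when `Y_t` has the density predicted by the particle belief. -/
def nextLaw [NeZero N] (R : Resampling N) (t : ℕ) (w : W) (z : Particles K X N) (u : M.U t) :
    Measure (W × Particles K X N) :=
  ((volume : Measure (EuclideanSpace ℝ (Fin n))).withDensity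
    fun y => ENNReal.ofReal (M.density t (particleBelief z) u y)).bind
      fun y => (M.ext (w, y)).prod (M.filterStep R t w z u y)

/-- Backward induction for the particle Bellman equation, with `m` stages to go from time `t`. -/
def particleValueToGo [NeZero N] (R : Resampling N) : (m t : ℕ) → W → Particles K X N → ℝ
  | 0, _, _, _ => 0
  | m + 1, t, w, z => ⨅ u : M.U t, (M.stageCost t w (particleBelief z) u +
      ∫ q, particleValueToGo R m (t + 1) q.1 q.2 ∂(M.nextLaw R t w z u))

/-- The particle value `V_t^{*,(N)}` with horizon `T`. -/
def particleValue [NeZero N] (R : Resampling N) (T t : ℕ) (w : W) (z : Particles K X N) : ℝ :=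
  M.particleValueToGo R (T + 1 - t) t w z

/-- The law of the particle system at time `t` along a history: `N` independent draws from `β₁`
with weights `1 / N` at time `1`, then the steps of the particle filter (the entry at time `0` is
not used). -/
def filterLaw [NeZero N] (R : Resampling N) (β₁ : Belief K X) (w : ℕ → W)
    (u : (s : ℕ) → M.U s) (y : ℕ → EuclideanSpace ℝ (Fin n)) : ℕ → Measure (Particles K X N)
  | 0 => (Measure.pi fun _ => (β₁ : Measure (Fin K × X))).map fun x => (x, uniformWeights N)
  | 1 => (Measure.pi fun _ => (β₁ : Measure (Fin K × X))).map fun x => (x, uniformWeights N)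
  | s + 2 => (filterLaw R β₁ w u y (s + 1)).bind fun z =>
      M.filterStep R (s + 1) (w (s + 1)) z (u (s + 1)) (y (s + 1))

end Model

end ParticleBelief

end

/-! The proof adds two limits. The exact value is continuous in the belief
(`regularValue_valueToGo`) and the particle beliefs converge weakly to the exact belief almost
surely (`ae_tendsto_particleBelief`), so the exact value at the particle belief converges. The
particle value minus the exact value at the particle belief tends to 0 uniformly over all systems
with weights at most `C / (N + 1)` (`eventually_abs_particleValueToGo_sub_le`).

Continuity is a backward induction: beliefs on a compact space form a compact space, the Feller
property makes the update continuous, the envelopes justify dominated convergence in the stage cost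
and in the expectation, and the infimum runs over a compact set.

Both limits use one concentration estimate. Given the current system, a filter step is, with or
without resampling, a family of independent draws with deterministic weights whose weighted mean law
is the exact update of the current particle belief (`exists_filterStep_eq`; unbiasedness of the
resampling enters here). If the weights are at most `C / N`, Hoeffding's inequality bounds the
deviation of a test function exponentially in `N`, uniformly in the laws and weights; compactness
passes from finitely many test functions to any continuous function of the belief
(`exists_summable_tail`). The weight bound propagates: reweighting inflates a weight by at most `kUp
y / kLow y`, and resampling resets it. Along a fixed history the constants are deterministic, the
tails are summable, and Borel–Cantelli gives almost sure convergence for any joint law.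

In the value comparison, one step costs the error at the next system plus the fluctuation of the
exact value around the exact update. The new weight constant depends on `y`, and the estimates are
only pointwise in the next external input, so they are combined by dominated convergence along
sequences; arguing by contradiction keeps uniformity in the system and the decision, which the
infimum requires. -/

noncomputable section

namespace ParticleBelief

/-! ### Weak topology and measurability on spaces of probability measures -/

section General

/-- The inclusion of probability measures into measures is itself a Markov kernel, so this is
measurability of a kernel integral. -/
lemma measurable_integral_probabilityMeasure {S : Type*} [MeasurableSpace S] {f : S → ℝ}
    (hf : StronglyMeasurable f) :
    Measurable fun μ : ProbabilityMeasure S => ∫ x, f x ∂(μ : Measure S) := by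
  let κ : Kernel (ProbabilityMeasure S) S := ⟨fun μ => μ, measurable_subtype_coe⟩
  have : IsMarkovKernel κ :=
    ⟨fun μ => by change IsProbabilityMeasure (μ : Measure S); infer_instance⟩
  exact (StronglyMeasurable.integral_kernel_prod_right' (κ := κ)
    (hf.comp_measurable measurable_snd)).measurable

variable {S Q : Type*} [TopologicalSpace S] [MeasurableSpace S] [TopologicalSpace Q]

/-- On a compact space, the integral of a jointly continuous function depends continuously on the
measure and on the parameter. -/
lemma continuous_integral_param [CompactSpace S] [OpensMeasurableSpace S]
    {F : S → Q → ℝ} (hF : Continuous fun p : S × Q => F p.1 p.2) :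
    Continuous fun p : ProbabilityMeasure S × Q => ∫ x, F x p.2 ∂(p.1 : Measure S) := by
  -- The integrand moves continuously in sup norm, which controls its change uniformly in the
  -- measure; what remains is weak convergence against the fixed integrand `G q`.
  let G : Q → C(S, ℝ) := fun q =>
    ⟨fun x => F x q, hF.comp (by fun_prop : Continuous fun x : S => (x, q))⟩
  have hG : Continuous G :=
    ContinuousMap.continuous_of_continuous_uncurry _ (hF.comp continuous_swap)
  rw [continuous_iff_continuousAt]
  rintro ⟨μ, q⟩
  have h1 : Tendsto (fun p : ProbabilityMeasure S × Q => ∫ x, G q x ∂(p.1 : Measure S))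
      (𝓝 (μ, q)) (𝓝 (∫ x, G q x ∂(μ : Measure S))) :=
    ((ProbabilityMeasure.continuous_integral_continuousMap (G q)).comp
      continuous_fst).continuousAt
  have h2 : Tendsto (fun p : ProbabilityMeasure S × Q => ‖G p.2 - G q‖) (𝓝 (μ, q)) (𝓝 0) := by
    have : Continuous fun p : ProbabilityMeasure S × Q => ‖G p.2 - G q‖ := by fun_prop
    simpa using this.tendsto (μ, q)
  have hint : ∀ (f : C(S, ℝ)) (ν : ProbabilityMeasure S), Integrable f (ν : Measure S) :=
    fun f ν => f.continuous.integrable_of_hasCompactSupport (HasCompactSupport.of_compactSpace _)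
  have h3 : Tendsto (fun p : ProbabilityMeasure S × Q =>
      (∫ x, F x p.2 ∂(p.1 : Measure S)) - ∫ x, G q x ∂(p.1 : Measure S)) (𝓝 (μ, q)) (𝓝 0) := by
    refine squeeze_zero_norm (fun p => ?_) h2
    have : (∫ x, F x p.2 ∂(p.1 : Measure S)) - ∫ x, G q x ∂(p.1 : Measure S)
        = ∫ x, (G p.2 - G q) x ∂(p.1 : Measure S) :=
      (integral_sub (hint (G p.2) p.1) (hint (G q) p.1)).symm
    rw [this]
    simpa using norm_integral_le_of_norm_le_const (μ := (p.1 : Measure S))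
      (Eventually.of_forall fun x => (G p.2 - G q).norm_coe_le_norm x)
  have := h3.add h1
  simp only [sub_add_cancel, zero_add] at this
  exact this

/-- The weak topology has the preimages of open sets under integrals of bounded continuous functions
as a subbasis, and these are measurable for the evaluation σ-algebra; second countability suffices
to generate the Borel sets from a subbasis. Needed to treat a value continuous in the belief as
jointly measurable with the external input. -/
instance [OpensMeasurableSpace S] [SecondCountableTopology (ProbabilityMeasure S)] :
    OpensMeasurableSpace (ProbabilityMeasure S) := by
  let 𝒮 : Set (Set (ProbabilityMeasure S)) :=
    {A | ∃ (f : BoundedContinuousFunction S ℝ) (U : Set ℝ), IsOpen U ∧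
      (fun μ : ProbabilityMeasure S => ∫ x, f x ∂(μ : Measure S)) ⁻¹' U = A}
  have hgen : (inferInstance : TopologicalSpace (ProbabilityMeasure S)) =
      TopologicalSpace.generateFrom 𝒮 := by
    refine le_antisymm (le_generateFrom ?_) ?_
    · rintro _ ⟨f, U, hU, rfl⟩
      exact hU.preimage (ProbabilityMeasure.continuous_integral_boundedContinuousFunction f)
    · rw [← continuous_id_iff_le]
      refine (@ProbabilityMeasure.continuous_iff_forall_continuous_integral S _ _ _ _
        (TopologicalSpace.generateFrom 𝒮) _).2 fun f => ?_
      refine continuous_def.2 fun U hU => ?_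
      exact TopologicalSpace.isOpen_generateFrom_of_mem ⟨f, U, hU, rfl⟩
  constructor
  rw [borel_eq_generateFrom_of_subbasis hgen]
  refine MeasurableSpace.generateFrom_le ?_
  rintro _ ⟨f, U, hU, rfl⟩
  exact measurable_integral_probabilityMeasure 
    f.continuous.measurable.stronglyMeasurable hU.measurableSet

/-- A continuous function on the probability measures on a compact space is uniformly continuous
with respect to the integrals of finitely many continuous functions. -/
lemma exists_finset_integral_close [CompactSpace S] [TopologicalSpace.MetrizableSpace S]
    [BorelSpace S] {V : ProbabilityMeasure S → ℝ} (hV : Continuous V) {ε : ℝ} (hε : 0 < ε) :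
    ∃ G : Finset (BoundedContinuousFunction S ℝ), ∀ μ ν : ProbabilityMeasure S,
      (∀ g ∈ G, |∫ x, g x ∂(μ : Measure S) - ∫ x, g x ∂(ν : Measure S)| ≤ 1) →
        |V μ - V ν| < ε := by
  have hD : IsCompact {p : ProbabilityMeasure S × ProbabilityMeasure S | ε ≤ |V p.1 - V p.2|} :=
    (isClosed_le continuous_const (by fun_prop)).isCompact
  have hI : ∀ g : BoundedContinuousFunction S ℝ,
      Continuous fun μ : ProbabilityMeasure S => ∫ x, g x ∂(μ : Measure S) :=
    ProbabilityMeasure.continuous_integral_boundedContinuousFunction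
  -- A pair with `V`-gap at least `ε` consists of distinct measures, so some test function separates
  -- it. The sets separated by more than 1 form an open cover of a compact set.
  obtain ⟨G, hG⟩ := hD.elim_finite_subcover
    (fun g : BoundedContinuousFunction S ℝ => {p : ProbabilityMeasure S × ProbabilityMeasure S |
      1 < |∫ x, g x ∂(p.1 : Measure S) - ∫ x, g x ∂(p.2 : Measure S)|})
    (fun g => isOpen_lt continuous_const
      (((hI g).comp continuous_fst).sub ((hI g).comp continuous_snd)).abs) (by
      rintro ⟨μ, ν⟩ hp
      have hne : μ ≠ ν := by
        rintro rfl
        have : ε ≤ |V μ - V μ| := hp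
        rw [sub_self, abs_zero] at this
        exact absurd this hε.not_ge
      have : ∃ g : BoundedContinuousFunction S ℝ,
          ∫ x, g x ∂(μ : Measure S) ≠ ∫ x, g x ∂(ν : Measure S) := by
        by_contra! h
        refine hne (tendsto_nhds_unique
          (ProbabilityMeasure.tendsto_iff_forall_integral_tendsto.2 fun g => ?_)
          (tendsto_const_nhds : Tendsto (fun _ : ℕ => ν) atTop (𝓝 ν)))
        rw [h g]
        exact tendsto_const_nhds
      obtain ⟨g, hg⟩ := this
      set c := |∫ x, g x ∂(μ : Measure S) - ∫ x, g x ∂(ν : Measure S)| with hc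
      have hc0 : 0 < c := abs_pos.2 (sub_ne_zero.2 hg)
      -- Rescaling makes the separation equal to 2, hence greater than 1.
      refine Set.mem_iUnion.2 ⟨(2 / c) • g, ?_⟩
      simp only [Set.mem_ofPred_eq, BoundedContinuousFunction.coe_smul, smul_eq_mul]
      rw [integral_const_mul, integral_const_mul, ← mul_sub, abs_mul, ← hc,
        abs_of_pos (by positivity), div_mul_cancel₀ _ hc0.ne']
      norm_num)
  refine ⟨G, fun μ ν h => ?_⟩
  by_contra! hlt
  obtain ⟨g, hg⟩ := Set.mem_iUnion.1 (hG (show (μ, ν) ∈ _ from hlt))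
  obtain ⟨hgG, hg⟩ := Set.mem_iUnion.1 hg
  exact absurd (h g hgG) (not_le.2 hg)

end General

/-! ### Infima over the decision variable -/

section Infimum

lemma continuous_iInf_of_compactSpace {B U : Type*} [TopologicalSpace B] [TopologicalSpace U]
    [CompactSpace U] {f : B → U → ℝ} (hf : Continuous fun p : B × U => f p.1 p.2) :
    Continuous fun b => ⨅ u, f b u := by
  have := (isCompact_univ (X := U)).continuous_sInf (f := f) hf
  simpa [Set.image_univ, sInf_range] using this

/-- By continuity the decisions with value below `c` form an open set, so a dense sequence already
detects whether the infimum is below `c`. -/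
lemma measurable_iInf_of_continuous {A U : Type*} [MeasurableSpace A] [TopologicalSpace U]
    [TopologicalSpace.SeparableSpace U] [Nonempty U] {f : A → U → ℝ}
    (hm : ∀ u, Measurable fun a => f a u) (hc : ∀ a, Continuous (f a))
    (hb : ∀ a, BddBelow (Set.range (f a))) : Measurable fun a => ⨅ u, f a u := by
  refine measurable_of_Iio fun c => ?_
  have : (fun a => ⨅ u, f a u) ⁻¹' Set.Iio c =
      ⋃ i : ℕ, {a | f a (TopologicalSpace.denseSeq U i) < c} := by
    ext a
    simp only [Set.mem_preimage, Set.mem_Iio, Set.mem_iUnion, Set.mem_ofPred_eq]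
    rw [ciInf_lt_iff (hb a)]
    constructor
    · rintro ⟨u, hu⟩
      obtain ⟨_, h, ⟨i, rfl⟩⟩ := (TopologicalSpace.denseRange_denseSeq U).inter_open_nonempty
        {u | f a u < c} (isOpen_lt (hc a) continuous_const) ⟨u, hu⟩
      exact ⟨i, h⟩
    · rintro ⟨i, hi⟩
      exact ⟨_, hi⟩
  rw [this]
  exact MeasurableSet.iUnion fun i => measurableSet_lt (hm _) measurable_const

lemma abs_iInf_sub_iInf_le {U : Type*} [Nonempty U] {f g : U → ℝ}
    (hf : BddBelow (Set.range f)) (hg : BddBelow (Set.range g)) {ε : ℝ}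
    (h : ∀ u, |f u - g u| ≤ ε) : |(⨅ u, f u) - ⨅ u, g u| ≤ ε := by
  have h1 : (⨅ u, f u) - ε ≤ ⨅ u, g u := le_ciInf fun u => by
    linarith [ciInf_le hf u, (abs_le.1 (h u)).2]
  have h2 : (⨅ u, g u) - ε ≤ ⨅ u, f u := le_ciInf fun u => by
    linarith [ciInf_le hg u, (abs_le.1 (h u)).1]
  rw [abs_le]
  constructor <;> linarith

lemma abs_iInf_le {U : Type*} [Nonempty U] {f : U → ℝ} {B : ℝ} (h : ∀ u, |f u| ≤ B) :
    |⨅ u, f u| ≤ B := by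
  have hb : BddBelow (Set.range f) := ⟨-B, by rintro _ ⟨u, rfl⟩; exact (abs_le.1 (h u)).1⟩
  obtain ⟨u⟩ := ‹Nonempty U›
  exact abs_le.2 ⟨le_ciInf fun u => (abs_le.1 (h u)).1, (ciInf_le hb u).trans (abs_le.1 (h u)).2⟩

end Infimum

/-! ### Product laws, mixtures and Hoeffding's inequality -/

section Laws

variable {A S : Type*} [MeasurableSpace A] [MeasurableSpace S]

/-- Boxes form a generating π-system, and the mass of a box is a finite product of measurable
functions. -/
lemma measurable_measure_pi {N : ℕ} {κ : Fin N → A → Measure S}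
    [∀ j a, IsProbabilityMeasure (κ j a)] (hκ : ∀ j, Measurable (κ j)) :
    Measurable fun a => Measure.pi fun j => κ j a := by
  refine Measurable.measure_of_isPiSystem_of_isProbabilityMeasure generateFrom_pi.symm isPiSystem_pi
    ?_
  rintro _ ⟨s, hs, rfl⟩
  simp only [Measure.pi_pi]
  exact Finset.measurable_prod _ fun j _ =>
    (Measure.measurable_coe (hs j (Set.mem_univ j))).comp (hκ j)

/-- Composition with a constant kernel represents the mixture, so the results on composed kernels
apply with integrability under the mixture as the only requirement on `f`. -/
lemma integrable_integral_bind {μ : Measure A} [SFinite μ] {κ : A → Measure S}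
    [∀ a, IsProbabilityMeasure (κ a)] (hκ : Measurable κ) {f : S → ℝ}
    (hf : Integrable f (μ.bind κ)) : Integrable (fun a => ∫ x, f x ∂(κ a)) μ := by
  let η : Kernel A S := ⟨κ, hκ⟩
  have : IsMarkovKernel η := ⟨fun a => by change IsProbabilityMeasure (κ a); infer_instance⟩
  have h : Integrable f ((η ∘ₖ Kernel.const Unit μ) ()) := by
    rw [Kernel.comp_apply]; exact hf
  exact h.integral_comp

lemma integral_bind_eq {μ : Measure A} [SFinite μ] {κ : A → Measure S}
    [∀ a, IsProbabilityMeasure (κ a)] (hκ : Measurable κ) {f : S → ℝ}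
    (hf : Integrable f (μ.bind κ)) : ∫ x, f x ∂(μ.bind κ) = ∫ a, ∫ x, f x ∂(κ a) ∂μ := by
  let η : Kernel A S := ⟨κ, hκ⟩
  have : IsMarkovKernel η := ⟨fun a => by change IsProbabilityMeasure (κ a); infer_instance⟩
  have h : Integrable f ((η ∘ₖ Kernel.const Unit μ) ()) := by
    rw [Kernel.comp_apply]; exact hf
  have := Kernel.integral_comp h
  rw [Kernel.comp_apply] at this
  exact this

/-- Hoeffding's inequality for a weighted mean of independent bounded variables. -/
lemma measureReal_weighted_mean_ge_le {N : ℕ} (μ : Fin N → Measure S)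
    [∀ j, IsProbabilityMeasure (μ j)] (ω : stdSimplex ℝ (Fin N)) {C : ℝ}
    (hC : ∀ j, ω.1 j ≤ C / N) {g : S → ℝ} (hg : Measurable g) {b : ℝ} (hb : 0 < b)
    (hgb : ∀ x, |g x| ≤ b) {ε : ℝ} (hε : 0 ≤ ε) :
    (Measure.pi μ).real {x | ε ≤ |∑ j, ω.1 j * g (x j) - ∑ j, ω.1 j * ∫ x, g x ∂(μ j)|} ≤
      2 * Real.exp (-(ε ^ 2 / (2 * b ^ 2 * C) * N)) := by
  have key : ∀ (f : S → ℝ), Measurable f → (∀ x, |f x| ≤ b) →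
      (Measure.pi μ).real {x | ε ≤ ∑ j, ω.1 j * (f (x j) - ∫ x, f x ∂(μ j))} ≤
        Real.exp (-(ε ^ 2 / (2 * b ^ 2 * C) * N)) := by
    intro f hf hfb
    have hind : iIndepFun (fun j (x : Fin N → S) => ω.1 j * (f (x j) - ∫ x, f x ∂(μ j)))
        (Measure.pi μ) :=
      iIndepFun_pi (X := fun j (x : S) => ω.1 j * (f x - ∫ x, f x ∂(μ j)))
        fun j => ((hf.sub_const _).const_mul _).aemeasurable
    have hsub : ∀ j ∈ (Finset.univ : Finset (Fin N)),
        HasSubgaussianMGF (fun (x : Fin N → S) => ω.1 j * (f (x j) - ∫ x, f x ∂(μ j)))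
          (NNReal.mk ((ω.1 j) ^ 2) (sq_nonneg _) * (‖b - -b‖₊ / 2) ^ 2) (Measure.pi μ) := by
      intro j _
      -- Hoeffding's lemma on `[-b, b]` gives variance proxy `b ^ 2`, scaled by the squared weight.
      have h1 := (hasSubgaussianMGF_of_mem_Icc (μ := μ j) (X := f) (a := -b) (b := b)
        hf.aemeasurable (Eventually.of_forall fun x => abs_le.1 (hfb x))).const_mul (ω.1 j)
      refine HasSubgaussianMGF.of_map (Y := fun x : Fin N → S => x j)
        (X := fun x => ω.1 j * (f x - ∫ x, f x ∂(μ j))) (measurable_pi_apply j).aemeasurable ?_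
      rw [(measurePreserving_eval μ j).map_eq]
      exact h1
    refine (HasSubgaussianMGF.measure_sum_ge_le_of_iIndepFun hind hsub hε).trans ?_
    have hsum : ((∑ j, NNReal.mk ((ω.1 j) ^ 2) (sq_nonneg _) * (‖b - -b‖₊ / 2) ^ 2 : NNReal) : ℝ)
        = b ^ 2 * ∑ j, (ω.1 j) ^ 2 := by
      push_cast
      rw [Finset.mul_sum]
      refine Finset.sum_congr rfl fun j _ => ?_
      have : ‖b - -b‖ / 2 = b := by
        rw [sub_neg_eq_add, Real.norm_of_nonneg (by positivity)]; ring
      rw [this]; ring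
    rw [hsum]
    have hN : 0 < (N : ℝ) := by
      rcases Nat.eq_zero_or_pos N with rfl | h
      · have := ω.2.2
        simp at this
      · exact_mod_cast h
    have hpos : 0 < ∑ j, (ω.1 j) ^ 2 := by
      refine lt_of_le_of_ne (Finset.sum_nonneg fun j _ => sq_nonneg _) fun h => ?_
      have h0 : ∀ j, ω.1 j = 0 := fun j => by
        have := (Finset.sum_eq_zero_iff_of_nonneg fun j _ => sq_nonneg _).1 h.symm j
          (Finset.mem_univ j)
        exact pow_eq_zero_iff two_ne_zero |>.1 this
      have := ω.2.2
      simp [h0] at this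
    -- Weights of size at most `C / N` with sum 1 have square sum at most `C / N`; this makes the
    -- exponent linear in `N`.
    have hle : ∑ j, (ω.1 j) ^ 2 ≤ C / N := by
      calc ∑ j, (ω.1 j) ^ 2 ≤ ∑ j, C / N * ω.1 j := Finset.sum_le_sum fun j _ => by
            rw [sq]; exact mul_le_mul_of_nonneg_right (hC j) (ω.2.1 j)
        _ = C / N := by rw [← Finset.mul_sum, ω.2.2, mul_one]
    have hC0 : 0 < C := by
      have := hpos.trans_le hle
      by_contra! h
      exact absurd this (not_lt.2 (div_nonpos_of_nonpos_of_nonneg h hN.le))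
    rw [Real.exp_le_exp, neg_div, neg_le_neg_iff, div_mul_eq_mul_div,
      div_le_div_iff₀ (by positivity) (by positivity)]
    have : (∑ j, (ω.1 j) ^ 2) * N ≤ C := by rwa [le_div_iff₀ hN] at hle
    nlinarith [mul_le_mul_of_nonneg_left this (by positivity : 0 ≤ 2 * ε ^ 2 * b ^ 2)]
  have h1 := key g hg hgb
  have h2 := key (fun x => -g x) hg.neg (fun x => by simpa using hgb x)
  refine (measureReal_mono (s₂ := {x | ε ≤ ∑ j, ω.1 j * (g (x j) - ∫ x, g x ∂(μ j))} ∪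
    {x | ε ≤ ∑ j, ω.1 j * (-g (x j) - ∫ x, -g x ∂(μ j))}) fun x hx => ?_).trans
    ((measureReal_union_le _ _).trans (by linarith))
  have e1 : ∑ j, ω.1 j * g (x j) - ∑ j, ω.1 j * ∫ x, g x ∂(μ j) =
      ∑ j, ω.1 j * (g (x j) - ∫ x, g x ∂(μ j)) := by
    rw [← Finset.sum_sub_distrib]
    exact Finset.sum_congr rfl fun j _ => by ring
  have e2 : -(∑ j, ω.1 j * g (x j) - ∑ j, ω.1 j * ∫ x, g x ∂(μ j)) =
      ∑ j, ω.1 j * (-g (x j) - ∫ x, -g x ∂(μ j)) := by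
    rw [e1, ← Finset.sum_neg_distrib]
    exact Finset.sum_congr rfl fun j _ => by rw [integral_neg]; ring
  rcases le_abs.1 (show ε ≤ |_| from hx) with h | h
  · exact Or.inl (by rw [e1] at h; exact h)
  · exact Or.inr (by rw [e2] at h; exact h)

end Laws

/-! ### Densities of the released data under a belief -/

namespace Model

variable {n K d : ℕ} {X : Set (EuclideanSpace ℝ (Fin n))} {W : Type*} [MeasurableSpace W]
  {M : Model n K d X W} {kLow kUp : ℕ → EuclideanSpace ℝ (Fin n) → ℝ}

instance : IsMarkovKernel M.trans := M.trans_markov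

instance : IsMarkovKernel M.ext := M.ext_markov

/-- The indicator function of the parameter value `θ`. -/
def ind (θ : Fin K) (p : Fin K × X) : ℝ := if p.1 = θ then 1 else 0

lemma continuous_ind (θ : Fin K) : Continuous (ind θ : Fin K × X → ℝ) :=
  (continuous_of_discreteTopology (f := fun i : Fin K => if i = θ then (1 : ℝ) else 0)).comp
    continuous_fst

lemma ind_nonneg (θ : Fin K) (p : Fin K × X) : 0 ≤ ind θ p := by
  unfold ind; split_ifs <;> norm_num

lemma ind_le_one (θ : Fin K) (p : Fin K × X) : ind θ p ≤ 1 := by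
  unfold ind; split_ifs <;> norm_num

lemma measurableSet_fst_eq (θ : Fin K) : MeasurableSet {p : Fin K × X | p.1 = θ} :=
  measurable_fst (measurableSet_singleton θ)

lemma setIntegral_fst_eq (μ : Measure (Fin K × X)) (θ : Fin K) (f : Fin K × X → ℝ) :
    ∫ p in {p : Fin K × X | p.1 = θ}, f p ∂μ = ∫ p, ind θ p * f p ∂μ := by
  rw [← integral_indicator (measurableSet_fst_eq θ)]
  refine integral_congr_ae (Eventually.of_forall fun p => ?_)
  by_cases h : p.1 = θ <;> simp [ind, Set.indicator, h]

lemma marg_eq_integral (β : Belief K X) (θ : Fin K) :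
    marg β θ = ∫ p, ind θ p ∂(β : Measure (Fin K × X)) := by
  have := setIntegral_fst_eq (β : Measure (Fin K × X)) θ fun _ => 1
  simpa [marg] using this

lemma continuous_integral_of_continuous [CompactSpace X] {g : Fin K × X → ℝ} (hg : Continuous g) :
    Continuous fun β : Belief K X => ∫ p, g p ∂(β : Measure (Fin K × X)) :=
  ProbabilityMeasure.continuous_integral_continuousMap (⟨g, hg⟩ : C(Fin K × X, ℝ))

lemma integrable_of_continuous [CompactSpace X] {g : Fin K × X → ℝ} (hg : Continuous g)
    (μ : Measure (Fin K × X)) [IsFiniteMeasure μ] : Integrable g μ :=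
  hg.integrable_of_hasCompactSupport (HasCompactSupport.of_compactSpace _)

lemma continuous_marg [CompactSpace X] (θ : Fin K) :
    Continuous fun β : Belief K X => marg β θ := by
  simp only [marg_eq_integral]
  exact continuous_integral_of_continuous (continuous_ind θ)

lemma marg_nonneg (β : Belief K X) (θ : Fin K) : 0 ≤ marg β θ := measureReal_nonneg

lemma marg_le_one (β : Belief K X) (θ : Fin K) : marg β θ ≤ 1 := measureReal_le_one

lemma sum_ind (p : Fin K × X) : ∑ θ, ind θ p = 1 := by simp [ind]

/-- The policy density is jointly continuous in the parameter, the state, the belief and the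
decision variable. -/
lemma continuous_k (hM : M.Regular kLow kUp) (t : ℕ) (y : EuclideanSpace ℝ (Fin n)) :
    Continuous fun q : (Fin K × X) × (Belief K X × M.U t) =>
      M.k t y q.1.1 q.1.2 q.2.1 q.2.2 := by
  have h : Continuous fun q : Fin K × (X × Belief K X × M.U t) =>
      M.k t y q.1 q.2.1 q.2.2.1 q.2.2.2 := by
    rw [continuous_prod_of_discrete_left]
    intro θ
    rw [continuous_iff_continuousAt]
    rintro ⟨x₀, β₀, u₀⟩
    obtain ⟨L, hL⟩ := hM.lipschitz t
    have h1 : Tendsto (fun q : X × Belief K X × M.U t => M.k t y θ q.1 q.2.1 u₀)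
        (𝓝 (x₀, β₀, u₀)) (𝓝 (M.k t y θ x₀ β₀ u₀)) :=
      ((M.k_continuous t y θ u₀).comp
        (by fun_prop : Continuous fun q : X × Belief K X × M.U t => (q.1, q.2.1))).tendsto
          (x₀, β₀, u₀)
    -- The Lipschitz bound in the decision is uniform in state and belief, so it upgrades continuity
    -- at the fixed `u₀` to joint continuity.
    have h2 : Tendsto (fun q : X × Belief K X × M.U t =>
        L * ‖(q.2.2 : EuclideanSpace ℝ (Fin d)) - u₀‖ * kUp t y) (𝓝 (x₀, β₀, u₀)) (𝓝 0) := by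
      have : Continuous fun q : X × Belief K X × M.U t =>
        L * ‖(q.2.2 : EuclideanSpace ℝ (Fin d)) - u₀‖ * kUp t y := by fun_prop
      simpa using this.tendsto (x₀, β₀, u₀)
    have h3 : Tendsto (fun q : X × Belief K X × M.U t =>
        M.k t y θ q.1 q.2.1 q.2.2 - M.k t y θ q.1 q.2.1 u₀) (𝓝 (x₀, β₀, u₀)) (𝓝 0) :=
      squeeze_zero_norm (fun q => hL q.2.2 u₀ θ q.1 q.2.1 y) h2
    have := h3.add h1
    simp only [sub_add_cancel, zero_add] at this
    exact this
  exact h.comp (by fun_prop : Continuous fun q : (Fin K × X) × (Belief K X × M.U t) =>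
    (q.1.1, q.1.2, q.2.1, q.2.2))

lemma measurable_k [CompactSpace X] (t : ℕ) (β : Belief K X) (u : M.U t) :
    Measurable fun q : (Fin K × X) × EuclideanSpace ℝ (Fin n) =>
      M.k t q.2 q.1.1 q.1.2 β u :=
  measurable_uncurry_of_continuous_of_measurable
    (u := fun (p : Fin K × X) (y : EuclideanSpace ℝ (Fin n)) => M.k t y p.1 p.2 β u)
    (fun y => M.continuous_density t β u y) (fun p => M.k_measurable t p.1 p.2 β u)

/-- The joint density of the parameter and the released data. -/
def jointDensity (M : Model n K d X W) (t : ℕ) (β : Belief K X) (u : M.U t) (θ : Fin K)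
    (y : EuclideanSpace ℝ (Fin n)) : ℝ :=
  ∫ p, ind θ p * M.k t y p.1 p.2 β u ∂(β : Measure (Fin K × X))

lemma integrable_k [CompactSpace X] (t : ℕ) (β : Belief K X) (u : M.U t)
    (y : EuclideanSpace ℝ (Fin n)) :
    Integrable (fun p : Fin K × X => M.k t y p.1 p.2 β u) (β : Measure (Fin K × X)) :=
  integrable_of_continuous (M.continuous_density t β u y) _

lemma integrable_ind_mul_k [CompactSpace X] (t : ℕ) (β : Belief K X) (u : M.U t) (θ : Fin K)
    (y : EuclideanSpace ℝ (Fin n)) :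
    Integrable (fun p : Fin K × X => ind θ p * M.k t y p.1 p.2 β u) (β : Measure (Fin K × X)) :=
  integrable_of_continuous ((continuous_ind θ).mul (M.continuous_density t β u y)) _

lemma condDensity_eq (t : ℕ) (β : Belief K X) (u : M.U t) (θ : Fin K)
    (y : EuclideanSpace ℝ (Fin n)) :
    M.condDensity t β u θ y = (marg β θ)⁻¹ * M.jointDensity t β u θ y := by
  rw [condDensity, jointDensity, setIntegral_fst_eq]
  congr 1
  refine integral_congr_ae (Eventually.of_forall fun p => ?_)
  by_cases h : p.1 = θ <;> simp [ind, h]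

lemma marg_mul_kLow_le_jointDensity [CompactSpace X] (hM : M.Regular kLow kUp) (t : ℕ)
    (β : Belief K X) (u : M.U t) (θ : Fin K) (y : EuclideanSpace ℝ (Fin n)) :
    marg β θ * kLow t y ≤ M.jointDensity t β u θ y := by
  rw [marg_eq_integral, ← integral_mul_const]
  exact integral_mono ((integrable_of_continuous (continuous_ind θ) _).mul_const _)
    (integrable_ind_mul_k t β u θ y) fun p =>
      mul_le_mul_of_nonneg_left (hM.kLow_le _ _ _ _ _ _) (ind_nonneg θ p)

lemma jointDensity_le_marg_mul_kUp [CompactSpace X] (hM : M.Regular kLow kUp) (t : ℕ)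
    (β : Belief K X) (u : M.U t) (θ : Fin K) (y : EuclideanSpace ℝ (Fin n)) :
    M.jointDensity t β u θ y ≤ marg β θ * kUp t y := by
  rw [marg_eq_integral, ← integral_mul_const]
  exact integral_mono (integrable_ind_mul_k t β u θ y)
    ((integrable_of_continuous (continuous_ind θ) _).mul_const _) fun p =>
      mul_le_mul_of_nonneg_left (hM.le_kUp _ _ _ _ _ _) (ind_nonneg θ p)

/-- When `θ` has no mass the convention `0⁻¹ = 0` is harmless: the envelopes squeeze the joint
density to 0. Working with joint densities avoids the division, which is discontinuous in the belief
at zero mass. -/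
lemma marg_mul_condDensity [CompactSpace X] (hM : M.Regular kLow kUp) (t : ℕ)
    (β : Belief K X) (u : M.U t) (θ : Fin K) (y : EuclideanSpace ℝ (Fin n)) :
    marg β θ * M.condDensity t β u θ y = M.jointDensity t β u θ y := by
  rw [condDensity_eq]
  by_cases h : marg β θ = 0
  · have h1 := marg_mul_kLow_le_jointDensity hM t β u θ y
    have h2 := jointDensity_le_marg_mul_kUp hM t β u θ y
    rw [h, zero_mul] at h1 h2
    rw [h, zero_mul, le_antisymm h2 h1]
  · rw [mul_inv_cancel_left₀ h]

lemma density_eq_integral [CompactSpace X] (hM : M.Regular kLow kUp) (t : ℕ)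
    (β : Belief K X) (u : M.U t) (y : EuclideanSpace ℝ (Fin n)) :
    M.density t β u y = ∫ p, M.k t y p.1 p.2 β u ∂(β : Measure (Fin K × X)) := by
  simp only [density, marg_mul_condDensity hM, jointDensity]
  rw [← integral_finsetSum _ fun θ _ => integrable_ind_mul_k t β u θ y]
  simp only [← Finset.sum_mul, sum_ind, one_mul]

lemma kLow_le_density [CompactSpace X] (hM : M.Regular kLow kUp) (t : ℕ)
    (β : Belief K X) (u : M.U t) (y : EuclideanSpace ℝ (Fin n)) :
    kLow t y ≤ M.density t β u y := by
  rw [density_eq_integral hM]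
  simpa using integral_mono (integrable_const (kLow t y)) (integrable_k t β u y)
    fun p => hM.kLow_le _ _ _ _ _ _

lemma density_le_kUp [CompactSpace X] (hM : M.Regular kLow kUp) (t : ℕ)
    (β : Belief K X) (u : M.U t) (y : EuclideanSpace ℝ (Fin n)) :
    M.density t β u y ≤ kUp t y := by
  rw [density_eq_integral hM]
  simpa using integral_mono (integrable_k t β u y) (integrable_const (kUp t y))
    fun p => hM.le_kUp _ _ _ _ _ _

lemma density_pos [CompactSpace X] (hM : M.Regular kLow kUp) (t : ℕ)
    (β : Belief K X) (u : M.U t) (y : EuclideanSpace ℝ (Fin n)) : 0 < M.density t β u y :=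
  (hM.kLow_pos t y).trans_le (kLow_le_density hM t β u y)

lemma continuous_jointDensity [CompactSpace X] (hM : M.Regular kLow kUp) (t : ℕ) (θ : Fin K)
    (y : EuclideanSpace ℝ (Fin n)) :
    Continuous fun q : Belief K X × M.U t => M.jointDensity t q.1 q.2 θ y := by
  have := continuous_integral_param (S := Fin K × X) (Q := Belief K X × M.U t)
    (F := fun p q => ind θ p * M.k t y p.1 p.2 q.1 q.2)
    (((continuous_ind θ).comp continuous_fst).mul (continuous_k hM t y))
  exact this.comp (by fun_prop : Continuous fun q : Belief K X × M.U t => (q.1, q))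

lemma continuous_density_param [CompactSpace X] (hM : M.Regular kLow kUp) (t : ℕ)
    (y : EuclideanSpace ℝ (Fin n)) :
    Continuous fun q : Belief K X × M.U t => M.density t q.1 q.2 y := by
  simp only [density, marg_mul_condDensity hM]
  exact continuous_finsetSum _ fun θ _ => continuous_jointDensity hM t θ y

lemma measurable_jointDensity [CompactSpace X] (t : ℕ) (β : Belief K X) (u : M.U t) (θ : Fin K) :
    Measurable fun y => M.jointDensity t β u θ y := by
  have : Measurable fun q : (Fin K × X) × EuclideanSpace ℝ (Fin n) =>
      ind θ q.1 * M.k t q.2 q.1.1 q.1.2 β u :=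
    ((continuous_ind θ).measurable.comp measurable_fst).mul (measurable_k t β u)
  exact (this.stronglyMeasurable.integral_prod_left').measurable

lemma measurable_density [CompactSpace X] (hM : M.Regular kLow kUp) (t : ℕ) (β : Belief K X)
    (u : M.U t) : Measurable fun y => M.density t β u y := by
  simp only [density, marg_mul_condDensity hM]
  exact Finset.measurable_fun_sum _ fun θ _ => measurable_jointDensity t β u θ

lemma lintegral_density [CompactSpace X] (hM : M.Regular kLow kUp) (t : ℕ) (β : Belief K X)
    (u : M.U t) : ∫⁻ y, ENNReal.ofReal (M.density t β u y) = 1 := by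
  have h : ∀ y, ENNReal.ofReal (M.density t β u y) =
      ∫⁻ p, ENNReal.ofReal (M.k t y p.1 p.2 β u) ∂(β : Measure (Fin K × X)) := fun y => by
    rw [density_eq_integral hM, ofReal_integral_eq_lintegral_ofReal (integrable_k t β u y)
      (Eventually.of_forall fun p => (M.k_pos _ _ _ _ _ _).le)]
  simp only [h]
  rw [lintegral_lintegral_swap]
  · simp only [M.k_lintegral, lintegral_one, measure_univ]
  · exact ((measurable_k t β u).comp measurable_swap).ennreal_ofReal.aemeasurable

/-! ### Mutual information -/

/-- The integrand of the mutual information. -/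
def infoIntegrand (M : Model n K d X W) (t : ℕ) (β : Belief K X) (u : M.U t) (θ : Fin K)
    (y : EuclideanSpace ℝ (Fin n)) : ℝ :=
  M.jointDensity t β u θ y * Real.log (M.condDensity t β u θ y / M.density t β u y)

lemma mutualInfo_eq [CompactSpace X] (hM : M.Regular kLow kUp) (t : ℕ) (β : Belief K X)
    (u : M.U t) : M.mutualInfo t β u = ∑ θ, ∫ y, M.infoIntegrand t β u θ y := by
  simp only [mutualInfo, infoIntegrand, ← integral_const_mul, ← mul_assoc,
    marg_mul_condDensity hM]

lemma jointDensity_nonneg [CompactSpace X] (hM : M.Regular kLow kUp) (t : ℕ) (β : Belief K X)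
    (u : M.U t) (θ : Fin K) (y : EuclideanSpace ℝ (Fin n)) : 0 ≤ M.jointDensity t β u θ y :=
  (mul_nonneg (marg_nonneg β θ) (hM.kLow_pos t y).le).trans
    (marg_mul_kLow_le_jointDensity hM t β u θ y)

lemma abs_log_div_le {a b c e : ℝ} (ha : 0 < a) (h1 : a ≤ c) (h2 : c ≤ b) (h3 : a ≤ e)
    (h4 : e ≤ b) : |Real.log (c / e)| ≤ |Real.log a| + |Real.log b| := by
  rw [Real.log_div (ha.trans_le h1).ne' (ha.trans_le h3).ne']
  have l1 := Real.log_le_log ha h1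
  have l2 := Real.log_le_log (ha.trans_le h1) h2
  have l3 := Real.log_le_log ha h3
  have l4 := Real.log_le_log (ha.trans_le h3) h4
  have := neg_abs_le (Real.log a)
  have := le_abs_self (Real.log b)
  rw [abs_le]
  constructor <;> linarith

/-- Positivity of the upper envelope is inherited from the density it dominates; hence the belief
and decision among the arguments. -/
lemma kUp_pos [CompactSpace X] (hM : M.Regular kLow kUp) (t : ℕ) (β : Belief K X)
    (u : M.U t) (y : EuclideanSpace ℝ (Fin n)) : 0 < kUp t y :=
  (density_pos hM t β u y).trans_le (density_le_kUp hM t β u y)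

/-- Both densities in the logarithm lie between the envelopes. The factor `marg β θ` is kept because
it yields continuity at beliefs where `θ` has no mass. -/
lemma abs_infoIntegrand_le [CompactSpace X] (hM : M.Regular kLow kUp) (t : ℕ) (β : Belief K X)
    (u : M.U t) (θ : Fin K) (y : EuclideanSpace ℝ (Fin n)) :
    |M.infoIntegrand t β u θ y| ≤
      marg β θ * (kUp t y * (1 + |Real.log (kLow t y)| + |Real.log (kUp t y)|)) := by
  have hup := kUp_pos hM t β u y
  have h0 := jointDensity_nonneg hM t β u θ y
  have h1 := marg_mul_kLow_le_jointDensity hM t β u θ y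
  have h2 := jointDensity_le_marg_mul_kUp hM t β u θ y
  rw [infoIntegrand, abs_mul, abs_of_nonneg h0]
  rcases (marg_nonneg β θ).eq_or_lt with h | h
  · rw [← h, zero_mul] at h2
    rw [← h, le_antisymm h2 h0, zero_mul, zero_mul]
  · have hlog : |Real.log (M.condDensity t β u θ y / M.density t β u y)| ≤
        |Real.log (kLow t y)| + |Real.log (kUp t y)| := by
      refine abs_log_div_le (hM.kLow_pos t y) ?_ ?_ (kLow_le_density hM t β u y)
        (density_le_kUp hM t β u y)
      · rw [condDensity_eq, le_inv_mul_iff₀ h]; exact h1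
      · rw [condDensity_eq, inv_mul_le_iff₀ h]; exact h2
    calc _ ≤ (marg β θ * kUp t y) * (|Real.log (kLow t y)| + |Real.log (kUp t y)|) :=
          mul_le_mul h2 hlog (abs_nonneg _) (by positivity)
      _ ≤ (marg β θ * kUp t y) * (1 + |Real.log (kLow t y)| + |Real.log (kUp t y)|) :=
          mul_le_mul_of_nonneg_left (by linarith) (by positivity)
      _ = _ := by ring

lemma continuous_infoIntegrand [CompactSpace X] (hM : M.Regular kLow kUp) (t : ℕ) (θ : Fin K)
    (y : EuclideanSpace ℝ (Fin n)) :
    Continuous fun q : Belief K X × M.U t => M.infoIntegrand t q.1 q.2 θ y := by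
  rw [continuous_iff_continuousAt]
  rintro ⟨β, u⟩
  have hm : Continuous fun q : Belief K X × M.U t => marg q.1 θ :=
    (continuous_marg θ).comp continuous_fst
  have hj := continuous_jointDensity hM t θ y
  -- At zero mass the conditional density has no useful limit, but the bound proportional to the
  -- mass forces the integrand to 0. At positive mass every quotient and logarithm is continuous.
  by_cases h : marg β θ = 0
  · have h0 : M.infoIntegrand t β u θ y = 0 := by
      have := abs_infoIntegrand_le hM t β u θ y
      rw [h, zero_mul] at this
      exact abs_nonpos_iff.1 this
    rw [ContinuousAt, h0]
    refine squeeze_zero_norm (fun q => abs_infoIntegrand_le hM t q.1 q.2 θ y) ?_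
    have := ((hm.mul_const (kUp t y * (1 + |Real.log (kLow t y)| + |Real.log (kUp t y)|))).tendsto
      (β, u))
    simpa [h] using this
  · have hpos : 0 < marg β θ := lt_of_le_of_ne (marg_nonneg β θ) (Ne.symm h)
    have hd := continuous_density_param hM t y
    unfold infoIntegrand
    simp only [condDensity_eq]
    refine hj.continuousAt.mul (ContinuousAt.log (((hm.continuousAt.inv₀ h).mul
      hj.continuousAt).div hd.continuousAt (density_pos hM t β u y).ne') ?_)
    have : 0 < M.jointDensity t β u θ y :=
      (mul_pos hpos (hM.kLow_pos t y)).trans_le (marg_mul_kLow_le_jointDensity hM t β u θ y)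
    have := density_pos hM t β u y
    positivity

lemma measurable_infoIntegrand [CompactSpace X] (hM : M.Regular kLow kUp) (t : ℕ) (β : Belief K X)
    (u : M.U t) (θ : Fin K) : Measurable fun y => M.infoIntegrand t β u θ y := by
  unfold infoIntegrand
  simp only [condDensity_eq]
  exact (measurable_jointDensity t β u θ).mul (Real.measurable_log.comp
    (((measurable_jointDensity t β u θ).const_mul _).div (measurable_density hM t β u)))

lemma norm_infoIntegrand_le [CompactSpace X] (hM : M.Regular kLow kUp) (t : ℕ) (β : Belief K X)
    (u : M.U t) (θ : Fin K) (y : EuclideanSpace ℝ (Fin n)) :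
    ‖M.infoIntegrand t β u θ y‖ ≤
      kUp t y * (1 + |Real.log (kLow t y)| + |Real.log (kUp t y)|) := by
  have hup := kUp_pos hM t β u y
  refine (abs_infoIntegrand_le hM t β u θ y).trans (mul_le_of_le_one_left ?_ (marg_le_one β θ))
  positivity

lemma continuous_mutualInfo [CompactSpace X] (hM : M.Regular kLow kUp) (t : ℕ) :
    Continuous fun q : Belief K X × M.U t => M.mutualInfo t q.1 q.2 := by
  simp only [mutualInfo_eq hM]
  refine continuous_finsetSum _ fun θ _ => ?_
  exact continuous_of_dominated
    (fun q => (measurable_infoIntegrand hM t q.1 q.2 θ).aestronglyMeasurable)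
    (fun q => Eventually.of_forall fun y => norm_infoIntegrand_le hM t q.1 q.2 θ y)
    (hM.integrable_log t) (Eventually.of_forall fun y => continuous_infoIntegrand hM t θ y)

lemma exists_abs_mutualInfo_le [CompactSpace X] (hM : M.Regular kLow kUp) (t : ℕ) :
    ∃ B : ℝ, ∀ (β : Belief K X) (u : M.U t), |M.mutualInfo t β u| ≤ B := by
  refine ⟨∑ _θ : Fin K, ∫ y, kUp t y * (1 + |Real.log (kLow t y)| + |Real.log (kUp t y)|),
    fun β u => ?_⟩
  rw [mutualInfo_eq hM]
  refine (Finset.abs_sum_le_sum_abs _ _).trans (Finset.sum_le_sum fun θ _ => ?_)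
  exact norm_integral_le_of_norm_le (hM.integrable_log t)
    (Eventually.of_forall fun y => norm_infoIntegrand_le hM t β u θ y)

/-- The mean of a bounded function with respect to a probability measure has the same bound. -/
lemma abs_integral_le_of_abs_le {S : Type*} [MeasurableSpace S] {μ : Measure S}
    [IsProbabilityMeasure μ] {f : S → ℝ} {B : ℝ} (h : ∀ x, |f x| ≤ B) : |∫ x, f x ∂μ| ≤ B := by
  have := norm_integral_le_of_norm_le_const (μ := μ) (f := f) (C := B) (Eventually.of_forall h)
  simpa using this

/-! ### System cost and distortion -/

/-- The state transition as a probability measure. -/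
def transPM (M : Model n K d X W) (θ : Fin K) (w : W) (x : X) : ProbabilityMeasure X :=
  ⟨M.trans (θ, x, w), inferInstance⟩

/-- The Feller property is weak continuity tested on one function at a time. -/
lemma continuous_transPM (hM : M.Regular kLow kUp) (θ : Fin K) (w : W) :
    Continuous (M.transPM θ w) :=
  ProbabilityMeasure.continuous_iff_forall_continuous_integral.2 fun g => hM.feller θ w g

/-- The expected system cost given the state and the released data. -/
def meanCost (M : Model n K d X W) (w : W) (x : X) (y : EuclideanSpace ℝ (Fin n)) : ℝ :=
  ∫ x', M.r M.θstar x x' y ∂(M.trans (M.θstar, x, w))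

/-- The state enters both the integrand and the transition law, so `continuous_integral_param` is
applied along `x ↦ (law, x)`. -/
lemma continuous_meanCost [CompactSpace X] (hM : M.Regular kLow kUp) (w : W)
    (y : EuclideanSpace ℝ (Fin n)) : Continuous fun x => M.meanCost w x y := by
  have := continuous_integral_param (S := X) (Q := X)
    (F := fun x' x => M.r M.θstar x x' y)
    (hM.r_continuous.comp (by fun_prop : Continuous fun q : X × X => (M.θstar, q.2, q.1, y)))
  exact this.comp ((continuous_transPM hM M.θstar w).prodMk continuous_id)

lemma measurable_meanCost (hM : M.Regular kLow kUp) :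
    Measurable fun q : W × X × EuclideanSpace ℝ (Fin n) => M.meanCost q.1 q.2.1 q.2.2 := by
  have hr : Measurable fun q : (W × X × EuclideanSpace ℝ (Fin n)) × X =>
      M.r M.θstar q.1.2.1 q.2 q.1.2.2 :=
    hM.r_continuous.measurable.comp (by fun_prop :
      Measurable fun q : (W × X × EuclideanSpace ℝ (Fin n)) × X =>
        (M.θstar, q.1.2.1, q.2, q.1.2.2))
  exact (StronglyMeasurable.integral_kernel_prod_right'
    (κ := M.trans.comap (fun q : W × X × EuclideanSpace ℝ (Fin n) => (M.θstar, q.2.1, q.1))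
      (by fun_prop)) hr.stronglyMeasurable).measurable

lemma exists_abs_meanCost_le (hM : M.Regular kLow kUp) :
    ∃ B : ℝ, ∀ w x y, |M.meanCost w x y| ≤ B := by
  obtain ⟨B, hB⟩ := hM.r_bounded
  exact ⟨B, fun w x y => abs_integral_le_of_abs_le fun x' => hB M.θstar x x' y⟩

/-- The expected system cost given the state. -/
def stateCost (M : Model n K d X W) (t : ℕ) (w : W) (β : Belief K X) (u : M.U t)
    (p : Fin K × X) : ℝ :=
  ind M.θstar p * ∫ y, M.meanCost w p.2 y * M.k t y p.1 p.2 β u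

lemma systemCost_eq (t : ℕ) (w : W) (β : Belief K X) (u : M.U t) :
    M.systemCost t w β u = ∫ p, M.stateCost t w β u p ∂(β : Measure (Fin K × X)) := by
  rw [systemCost, setIntegral_fst_eq]
  refine integral_congr_ae (Eventually.of_forall fun p => ?_)
  by_cases h : p.1 = M.θstar <;> simp [ind, h, meanCost, stateCost]

lemma continuous_stateCost [CompactSpace X] (hM : M.Regular kLow kUp) (t : ℕ) (w : W) :
    Continuous fun q : (Fin K × X) × (Belief K X × M.U t) =>
      M.stateCost t w q.2.1 q.2.2 q.1 := by
  obtain ⟨B, hB⟩ := exists_abs_meanCost_le hM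
  refine ((continuous_ind M.θstar).comp continuous_fst).mul ?_
  refine continuous_of_dominated (bound := fun y => B * kUp t y) (fun q => ?_)
    (fun q => Eventually.of_forall fun y => ?_) ((hM.integrable_kUp t).const_mul B)
    (Eventually.of_forall fun y => ?_)
  · exact (((measurable_meanCost hM).comp (by fun_prop :
      Measurable fun y : EuclideanSpace ℝ (Fin n) => (w, q.1.2, y))).mul
      (M.k_measurable t _ _ _ _)).aestronglyMeasurable
  · rw [norm_mul, Real.norm_of_nonneg (M.k_pos _ _ _ _ _ _).le]
    exact mul_le_mul (hB _ _ _) (hM.le_kUp _ _ _ _ _ _) (M.k_pos _ _ _ _ _ _).le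
      ((abs_nonneg _).trans (hB w q.1.2 y))
  · exact ((continuous_meanCost hM w y).comp (by fun_prop :
      Continuous fun q : (Fin K × X) × (Belief K X × M.U t) => q.1.2)).mul (continuous_k hM t y)

lemma continuous_systemCost [CompactSpace X] (hM : M.Regular kLow kUp) (t : ℕ) (w : W) :
    Continuous fun q : Belief K X × M.U t => M.systemCost t w q.1 q.2 := by
  simp only [systemCost_eq]
  exact (continuous_integral_param (S := Fin K × X) (Q := Belief K X × M.U t)
    (F := fun p q => M.stateCost t w q.1 q.2 p) (continuous_stateCost hM t w)).comp
    (by fun_prop : Continuous fun q : Belief K X × M.U t => (q.1, q))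

lemma exists_abs_systemCost_le [CompactSpace X] (hM : M.Regular kLow kUp) (t : ℕ) :
    ∃ B : ℝ, ∀ (w : W) (β : Belief K X) (u : M.U t), |M.systemCost t w β u| ≤ B := by
  obtain ⟨B, hB⟩ := exists_abs_meanCost_le hM
  refine ⟨∫ y, B * kUp t y, fun w β u => ?_⟩
  rw [systemCost_eq]
  refine abs_integral_le_of_abs_le fun p => ?_
  have : ‖∫ y, M.meanCost w p.2 y * M.k t y p.1 p.2 β u‖ ≤ ∫ y, B * kUp t y :=
    norm_integral_le_of_norm_le ((hM.integrable_kUp t).const_mul B)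
      (Eventually.of_forall fun y => by
        rw [norm_mul, Real.norm_of_nonneg (M.k_pos _ _ _ _ _ _).le]
        exact mul_le_mul (hB _ _ _) (hM.le_kUp _ _ _ _ _ _) (M.k_pos _ _ _ _ _ _).le
          ((abs_nonneg _).trans (hB w p.2 y)))
  rw [stateCost, abs_mul, abs_of_nonneg (ind_nonneg _ _)]
  exact (mul_le_of_le_one_left (norm_nonneg _) (ind_le_one _ _)).trans this

/-- `W` carries no topology, so measurability is the regularity in the external input that the
backward induction maintains. -/
lemma measurable_systemCost [CompactSpace X] (hM : M.Regular kLow kUp) (t : ℕ) (β : Belief K X)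
    (u : M.U t) : Measurable fun w => M.systemCost t w β u := by
  simp only [systemCost_eq]
  have h1 : Measurable fun q : (W × (Fin K × X)) × EuclideanSpace ℝ (Fin n) =>
      M.meanCost q.1.1 q.1.2.2 q.2 * M.k t q.2 q.1.2.1 q.1.2.2 β u :=
    ((measurable_meanCost hM).comp (by fun_prop :
      Measurable fun q : (W × (Fin K × X)) × EuclideanSpace ℝ (Fin n) =>
        (q.1.1, q.1.2.2, q.2))).mul
    ((measurable_k t β u).comp (by fun_prop :
      Measurable fun q : (W × (Fin K × X)) × EuclideanSpace ℝ (Fin n) => (q.1.2, q.2)))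
  have h2 : Measurable fun q : W × (Fin K × X) => M.stateCost t q.1 β u q.2 :=
    ((continuous_ind M.θstar).measurable.comp measurable_snd).mul
      (h1.stronglyMeasurable.integral_prod_right').measurable
  exact (h2.stronglyMeasurable.integral_prod_right').measurable

/-- The expected distortion given the parameter and the state. -/
def stateDistortion (M : Model n K d X W) (t : ℕ) (β : Belief K X) (u : M.U t)
    (p : Fin K × X) : ℝ :=
  ∫ y, M.dist p.2 y * M.k t y p.1 p.2 β u

lemma norm_dist_mul_k_le (hM : M.Regular kLow kUp) (t : ℕ)
    {D : EuclideanSpace ℝ (Fin n) → ℝ} (hD : ∀ x y, |M.dist x y| ≤ D y) (β : Belief K X)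
    (u : M.U t) (p : Fin K × X) (y : EuclideanSpace ℝ (Fin n)) :
    ‖M.dist p.2 y * M.k t y p.1 p.2 β u‖ ≤ D y * kUp t y := by
  rw [norm_mul, Real.norm_of_nonneg (M.k_pos _ _ _ _ _ _).le]
  exact mul_le_mul (hD _ _) (hM.le_kUp _ _ _ _ _ _) (M.k_pos _ _ _ _ _ _).le
    ((abs_nonneg _).trans (hD p.2 y))

lemma continuous_stateDistortion [CompactSpace X] (hM : M.Regular kLow kUp) (t : ℕ) :
    Continuous fun q : (Fin K × X) × (Belief K X × M.U t) =>
      M.stateDistortion t q.2.1 q.2.2 q.1 := by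
  obtain ⟨D, hD, hDi⟩ := hM.dist_integrable t
  refine continuous_of_dominated (bound := fun y => D y * kUp t y) (fun q => ?_)
    (fun q => Eventually.of_forall fun y => norm_dist_mul_k_le hM t hD _ _ _ _) hDi
    (Eventually.of_forall fun y => ?_)
  · exact ((hM.dist_continuous.measurable.comp (by fun_prop :
      Measurable fun y : EuclideanSpace ℝ (Fin n) => (q.1.2, y))).mul
      (M.k_measurable t _ _ _ _)).aestronglyMeasurable
  · exact (hM.dist_continuous.comp (by fun_prop :
      Continuous fun q : (Fin K × X) × (Belief K X × M.U t) => (q.1.2, y))).mul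
      (continuous_k hM t y)

lemma continuous_distortion [CompactSpace X] (hM : M.Regular kLow kUp) (t : ℕ) :
    Continuous fun q : Belief K X × M.U t => M.distortion t q.1 q.2 :=
  (continuous_integral_param (S := Fin K × X) (Q := Belief K X × M.U t)
    (F := fun p q => M.stateDistortion t q.1 q.2 p) (continuous_stateDistortion hM t)).comp
    (by fun_prop : Continuous fun q : Belief K X × M.U t => (q.1, q))

lemma exists_abs_distortion_le (hM : M.Regular kLow kUp) (t : ℕ) :
    ∃ B : ℝ, ∀ (β : Belief K X) (u : M.U t), |M.distortion t β u| ≤ B := by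
  obtain ⟨D, hD, hDi⟩ := hM.dist_integrable t
  refine ⟨∫ y, D y * kUp t y, fun β u => ?_⟩
  refine abs_integral_le_of_abs_le fun p => ?_
  exact norm_integral_le_of_norm_le hDi
    (Eventually.of_forall fun y => norm_dist_mul_k_le hM t hD _ _ _ _)

/-! ### Stage cost -/

lemma continuous_stageCost [CompactSpace X] (hM : M.Regular kLow kUp) (t : ℕ) (w : W) :
    Continuous fun q : Belief K X × M.U t => M.stageCost t w q.1 q.2 :=
  ((continuous_const.mul (continuous_mutualInfo hM t)).add (continuous_systemCost hM t w)).add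
    (continuous_const.mul ((continuous_distortion hM t).sub continuous_const))

lemma measurable_stageCost [CompactSpace X] (hM : M.Regular kLow kUp) (t : ℕ) (β : Belief K X)
    (u : M.U t) : Measurable fun w => M.stageCost t w β u :=
  ((measurable_systemCost hM t β u).const_add _).add_const _

lemma exists_abs_stageCost_le [CompactSpace X] (hM : M.Regular kLow kUp) (t : ℕ) :
    ∃ B : ℝ, ∀ (w : W) (β : Belief K X) (u : M.U t), |M.stageCost t w β u| ≤ B := by
  obtain ⟨B₁, h₁⟩ := exists_abs_mutualInfo_le hM t
  obtain ⟨B₂, h₂⟩ := exists_abs_systemCost_le hM t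
  obtain ⟨B₃, h₃⟩ := exists_abs_distortion_le hM t
  refine ⟨|M.ρ| * B₁ + B₂ + |M.lam| * (B₃ + |M.Dhat|), fun w β u => ?_⟩
  refine (abs_add_three _ _ _).trans (add_le_add (add_le_add ?_ (h₂ w β u)) ?_)
  · rw [abs_mul]
    exact mul_le_mul_of_nonneg_left (h₁ β u) (abs_nonneg _)
  · rw [abs_mul]
    exact mul_le_mul_of_nonneg_left ((abs_sub _ _).trans (add_le_add (h₃ β u) le_rfl))
      (abs_nonneg _)

/-! ### Belief update -/

lemma measurable_likelihood [CompactSpace X] (t : ℕ) (β : Belief K X) (u : M.U t)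
    (y : EuclideanSpace ℝ (Fin n)) : Measurable (M.likelihood t β u y) :=
  (M.continuous_density t β u y).measurable.ennreal_ofReal

lemma lintegral_likelihood [CompactSpace X] (hM : M.Regular kLow kUp) (t : ℕ) (β : Belief K X)
    (u : M.U t) (y : EuclideanSpace ℝ (Fin n)) :
    ∫⁻ p, M.likelihood t β u y p ∂(β : Measure (Fin K × X)) =
      ENNReal.ofReal (M.density t β u y) := by
  rw [density_eq_integral hM, ofReal_integral_eq_lintegral_ofReal (integrable_k t β u y)
    (Eventually.of_forall fun p => (M.k_pos _ _ _ _ _ _).le)]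
  rfl

lemma integral_posterior [CompactSpace X] (hM : M.Regular kLow kUp) (t : ℕ) (β : Belief K X)
    (u : M.U t) (y : EuclideanSpace ℝ (Fin n)) (g : Fin K × X → ℝ) :
    ∫ p, g p ∂(M.posterior t β u y) =
      (M.density t β u y)⁻¹ * ∫ p, M.k t y p.1 p.2 β u * g p ∂(β : Measure (Fin K × X)) := by
  rw [posterior, integral_smul_measure, lintegral_likelihood hM,
    integral_withDensity_eq_integral_toReal_smul (measurable_likelihood t β u y)
      (Eventually.of_forall fun p => ENNReal.ofReal_lt_top), ENNReal.toReal_inv,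
    ENNReal.toReal_ofReal (density_pos hM t β u y).le, smul_eq_mul]
  congr 1
  refine integral_congr_ae (Eventually.of_forall fun p => ?_)
  simp only [likelihood, ENNReal.toReal_ofReal (M.k_pos t y p.1 p.2 β u).le, smul_eq_mul]

lemma move_apply (w : W) (p : Fin K × X) :
    M.move w p = (Measure.dirac p.1).prod (M.trans (p.1, p.2, w)) := by
  rw [move, Kernel.prod_apply, Kernel.deterministic_apply, Kernel.comap_apply]

lemma integral_move [CompactSpace X] (w : W) (p : Fin K × X) {g : Fin K × X → ℝ}
    (hg : Continuous g) :
    ∫ q, g q ∂(M.move w p) = ∫ x', g (p.1, x') ∂(M.trans (p.1, p.2, w)) := by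
  rw [move_apply, Measure.dirac_prod, integral_map (by fun_prop)
    hg.measurable.aestronglyMeasurable]

lemma continuous_integral_move [CompactSpace X] (hM : M.Regular kLow kUp) (w : W)
    {g : Fin K × X → ℝ} (hg : Continuous g) :
    Continuous fun p => ∫ q, g q ∂(M.move w p) := by
  simp only [integral_move w _ hg]
  rw [continuous_prod_of_discrete_left]
  intro θ
  exact hM.feller θ w (BoundedContinuousFunction.mkOfCompact
    ⟨fun x' => g (θ, x'), hg.comp (by fun_prop)⟩)

/-- This ratio form serves twice: it shows that the update is continuous, and it identifies the mean
of a filter step. -/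
lemma integral_update [CompactSpace X] (hM : M.Regular kLow kUp) (t : ℕ) (w : W) (β : Belief K X)
    (u : M.U t) (y : EuclideanSpace ℝ (Fin n)) {g : Fin K × X → ℝ} (hg : Continuous g) :
    ∫ q, g q ∂(M.update t w β u y : Measure (Fin K × X)) =
      (M.density t β u y)⁻¹ * ∫ p, M.k t y p.1 p.2 β u * ∫ q, g q ∂(M.move w p)
        ∂(β : Measure (Fin K × X)) := by
  have h : ((M.update t w β u y : Belief K X) : Measure (Fin K × X)) =
    (M.posterior t β u y).bind (M.move w) := rfl
  have hi : Integrable g ((M.posterior t β u y).bind (M.move w)) := by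
    rw [← h]; exact integrable_of_continuous hg _
  rw [h, integral_bind_eq (M.move w).measurable hi, integral_posterior hM]

/-- The belief update is jointly continuous in the belief and the decision variable. -/
lemma continuous_update [CompactSpace X] (hM : M.Regular kLow kUp) (t : ℕ) (w : W)
    (y : EuclideanSpace ℝ (Fin n)) :
    Continuous fun q : Belief K X × M.U t => M.update t w q.1 q.2 y := by
  refine ProbabilityMeasure.continuous_iff_forall_continuous_integral.2 fun g => ?_
  simp only [integral_update hM t w _ _ y g.continuous]
  refine ((continuous_density_param hM t y).inv₀ fun q => (density_pos hM t q.1 q.2 y).ne').mul ?_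
  exact (continuous_integral_param (S := Fin K × X) (Q := Belief K X × M.U t)
    (F := fun p q => M.k t y p.1 p.2 q.1 q.2 * ∫ q, g q ∂(M.move w p))
    ((continuous_k hM t y).mul ((continuous_integral_move hM w g.continuous).comp
      continuous_fst))).comp
    (by fun_prop : Continuous fun q : Belief K X × M.U t => (q.1, q))

/-- The propagation of a (parameter, state) pair, as a kernel from the pair and the external
input. -/
def moveKernel (M : Model n K d X W) : Kernel (W × (Fin K × X)) (Fin K × X) :=
  (Kernel.deterministic (fun q : W × (Fin K × X) => q.2.1) (by fun_prop)) ×ₖ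
    (M.trans.comap (fun q => (q.2.1, q.2.2, q.1)) (by fun_prop))

lemma moveKernel_apply (q : W × (Fin K × X)) : M.moveKernel q = M.move q.1 q.2 := by
  rw [move_apply, moveKernel, Kernel.prod_apply, Kernel.deterministic_apply, Kernel.comap_apply]

/-- The belief update is jointly measurable in the external input and the released data. -/
lemma measurable_update [CompactSpace X] (hM : M.Regular kLow kUp) (t : ℕ) (β : Belief K X)
    (u : M.U t) :
    Measurable fun q : W × EuclideanSpace ℝ (Fin n) => M.update t q.1 β u q.2 := by
  refine Measurable.subtype_mk (Measure.measurable_of_measurable_coe _ fun s hs => ?_)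
  have h : ∀ q : W × EuclideanSpace ℝ (Fin n),
      (M.posterior t β u q.2).bind (M.move q.1) s =
      (ENNReal.ofReal (M.density t β u q.2))⁻¹ *
        ∫⁻ p, ENNReal.ofReal (M.k t q.2 p.1 p.2 β u) * M.moveKernel (q.1, p) s
          ∂(β : Measure (Fin K × X)) := by
    intro q
    have hm : Measurable fun p => M.move q.1 p s :=
      (Measure.measurable_coe hs).comp (M.move q.1).measurable
    rw [Measure.bind_apply hs (M.move q.1).measurable.aemeasurable, posterior,
      lintegral_smul_measure, lintegral_likelihood hM,
      lintegral_withDensity_eq_lintegral_mul _ (measurable_likelihood t β u q.2) hm]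
    simp only [moveKernel_apply, smul_eq_mul]
    rfl
  simp only [h]
  refine (((measurable_density hM t β u).comp measurable_snd).ennreal_ofReal.inv).mul ?_
  refine Measurable.lintegral_prod_right' (f := fun q : (W × EuclideanSpace ℝ (Fin n)) ×
    (Fin K × X) => ENNReal.ofReal (M.k t q.1.2 q.2.1 q.2.2 β u) * M.moveKernel (q.1.1, q.2) s) ?_
  exact ((measurable_k t β u).comp (by fun_prop : Measurable fun q :
      (W × EuclideanSpace ℝ (Fin n)) × (Fin K × X) => (q.2, q.1.2))).ennreal_ofReal.mul
    ((M.moveKernel.measurable_coe hs).comp (by fun_prop))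

/-! ### The exact value function -/

/-- The expected value of `f` at the next external input and belief. -/
def nextMean (M : Model n K d X W) (f : W → Belief K X → ℝ) (t : ℕ) (w : W) (β : Belief K X)
    (u : M.U t) : ℝ :=
  ∫ y, M.density t β u y * ∫ w', f w' (M.update t w β u y) ∂(M.ext (w, y))

/-- Bounded functions that are continuous in the belief and measurable in the external input. -/
structure RegularValue (f : W → Belief K X → ℝ) : Prop where
  bounded : ∃ B : ℝ, ∀ w β, |f w β| ≤ B
  continuous : ∀ w, Continuous (f w)
  measurable : ∀ β, Measurable fun w => f w β

/-- A Carathéodory function, continuous in one variable and measurable in the other, is jointly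
measurable. -/
lemma RegularValue.measurable_uncurry [CompactSpace X] {f : W → Belief K X → ℝ}
    (hf : RegularValue f) : Measurable fun q : W × Belief K X => f q.1 q.2 :=
  (measurable_uncurry_of_continuous_of_measurable (u := fun β w => f w β) hf.continuous
    hf.measurable).comp measurable_swap

lemma abs_integral_ext_le {f : W → Belief K X → ℝ} {B : ℝ} (hB : ∀ w β, |f w β| ≤ B)
    (q : W × EuclideanSpace ℝ (Fin n)) (β : Belief K X) :
    |∫ w', f w' β ∂(M.ext q)| ≤ B :=
  abs_integral_le_of_abs_le fun w' => hB w' β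

lemma RegularValue.measurable_integral_ext [CompactSpace X] (hM : M.Regular kLow kUp)
    {f : W → Belief K X → ℝ} (hf : RegularValue f) (t : ℕ) (β : Belief K X) (u : M.U t) :
    Measurable fun q : W × EuclideanSpace ℝ (Fin n) =>
      ∫ w', f w' (M.update t q.1 β u q.2) ∂(M.ext q) := by
  have : Measurable fun q : (W × EuclideanSpace ℝ (Fin n)) × W =>
      f q.2 (M.update t q.1.1 β u q.1.2) :=
    hf.measurable_uncurry.comp
      (measurable_snd.prodMk ((measurable_update hM t β u).comp measurable_fst))
  exact (StronglyMeasurable.integral_kernel_prod_right' (κ := M.ext)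
    this.stronglyMeasurable).measurable

lemma norm_density_mul_le [CompactSpace X] (hM : M.Regular kLow kUp) {f : W → Belief K X → ℝ}
    {B : ℝ} (hB : ∀ w β, |f w β| ≤ B) (t : ℕ) (w : W) (β : Belief K X) (u : M.U t)
    (y : EuclideanSpace ℝ (Fin n)) :
    ‖M.density t β u y * ∫ w', f w' (M.update t w β u y) ∂(M.ext (w, y))‖ ≤ kUp t y * B := by
  rw [norm_mul, Real.norm_of_nonneg (density_pos hM t β u y).le]
  exact mul_le_mul (density_le_kUp hM t β u y) (abs_integral_ext_le hB _ _) (norm_nonneg _)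
    (kUp_pos hM t β u y).le

/-- Two nested dominated convergences: over `y` with the upper envelope, and over the next external
input with a constant. -/
lemma RegularValue.continuous_nextMean [CompactSpace X] (hM : M.Regular kLow kUp)
    {f : W → Belief K X → ℝ} (hf : RegularValue f) (t : ℕ) (w : W) :
    Continuous fun q : Belief K X × M.U t => M.nextMean f t w q.1 q.2 := by
  obtain ⟨B, hB⟩ := hf.bounded
  refine continuous_of_dominated (bound := fun y => kUp t y * B) (fun q => ?_)
    (fun q => Eventually.of_forall fun y => norm_density_mul_le hM hB t w q.1 q.2 y)
    ((hM.integrable_kUp t).mul_const B) (Eventually.of_forall fun y => ?_)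
  · exact ((measurable_density hM t q.1 q.2).mul ((hf.measurable_integral_ext hM t q.1 q.2).comp
      measurable_prodMk_left)).aestronglyMeasurable
  · refine (continuous_density_param hM t y).mul ?_
    exact continuous_of_dominated (bound := fun _ => B)
      (fun q => (hf.measurable _).aestronglyMeasurable)
      (fun q => Eventually.of_forall fun w' => hB w' _) (integrable_const B)
      (Eventually.of_forall fun w' => (hf.continuous w').comp (continuous_update hM t w y))

lemma RegularValue.measurable_nextMean [CompactSpace X] (hM : M.Regular kLow kUp)
    {f : W → Belief K X → ℝ} (hf : RegularValue f) (t : ℕ) (β : Belief K X) (u : M.U t) :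
    Measurable fun w => M.nextMean f t w β u :=
  ((((measurable_density hM t β u).comp measurable_snd).mul
    (hf.measurable_integral_ext hM t β u)).stronglyMeasurable.integral_prod_right').measurable

lemma exists_abs_nextMean_le [CompactSpace X] (hM : M.Regular kLow kUp) {f : W → Belief K X → ℝ}
    {B : ℝ} (hB : ∀ w β, |f w β| ≤ B) (t : ℕ) :
    ∃ B' : ℝ, ∀ (w : W) (β : Belief K X) (u : M.U t), |M.nextMean f t w β u| ≤ B' :=
  ⟨∫ y, kUp t y * B, fun w β u => norm_integral_le_of_norm_le ((hM.integrable_kUp t).mul_const B)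
    (Eventually.of_forall fun y => norm_density_mul_le hM hB t w β u y)⟩

lemma valueToGo_succ (m t : ℕ) (w : W) (β : Belief K X) :
    M.valueToGo (m + 1) t w β =
      ⨅ u : M.U t, (M.stageCost t w β u + M.nextMean (M.valueToGo m (t + 1)) t w β u) := rfl

/-- The exact value function is bounded, continuous in the belief and measurable in the external
input. -/
lemma regularValue_valueToGo [CompactSpace X] (hM : M.Regular kLow kUp) (m t : ℕ) :
    RegularValue (M.valueToGo m t) := by
  induction m generalizing t with
  | zero => exact ⟨⟨0, by simp [valueToGo]⟩, fun w => by simp only [valueToGo]; fun_prop,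
      fun β => by simp only [valueToGo]; fun_prop⟩
  | succ m ih =>
    have : CompactSpace (M.U t) := isCompact_iff_compactSpace.1 (hM.U_compact t)
    have : Nonempty (M.U t) := (hM.U_nonempty t).to_subtype
    obtain ⟨B, hB⟩ := (ih (t + 1)).bounded
    obtain ⟨B₁, h₁⟩ := exists_abs_stageCost_le hM t
    obtain ⟨B₂, h₂⟩ := exists_abs_nextMean_le hM hB t
    have hc : ∀ w, Continuous fun q : Belief K X × M.U t =>
        M.stageCost t w q.1 q.2 + M.nextMean (M.valueToGo m (t + 1)) t w q.1 q.2 := fun w =>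
      (continuous_stageCost hM t w).add ((ih (t + 1)).continuous_nextMean hM t w)
    have hb : ∀ w β (u : M.U t), |M.stageCost t w β u +
        M.nextMean (M.valueToGo m (t + 1)) t w β u| ≤ B₁ + B₂ := fun w β u =>
      (abs_add_le _ _).trans (add_le_add (h₁ w β u) (h₂ w β u))
    have hm : ∀ β (u : M.U t), Measurable fun w => M.stageCost t w β u +
        M.nextMean (M.valueToGo m (t + 1)) t w β u := fun β u =>
      (measurable_stageCost hM t β u).add ((ih (t + 1)).measurable_nextMean hM t β u)
    have hv : M.valueToGo (m + 1) t = fun w β => ⨅ u : M.U t, (M.stageCost t w β u +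
        M.nextMean (M.valueToGo m (t + 1)) t w β u) :=
      funext fun w => funext fun β => valueToGo_succ m t w β
    rw [hv]
    refine ⟨⟨B₁ + B₂, fun w β => abs_iInf_le (hb w β)⟩, fun w => ?_, fun β => ?_⟩
    · exact continuous_iInf_of_compactSpace
        (f := fun β (u : M.U t) => M.stageCost t w β u +
          M.nextMean (M.valueToGo m (t + 1)) t w β u) (hc w)
    · refine measurable_iInf_of_continuous (f := fun w (u : M.U t) => M.stageCost t w β u +
        M.nextMean (M.valueToGo m (t + 1)) t w β u) (hm β) (fun w => ?_) fun w => ?_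
      · have hβ : Continuous fun u : M.U t => (β, u) := by fun_prop
        have h := (hc w).comp hβ
        exact h
      · exact ⟨-(B₁ + B₂), by rintro _ ⟨u, rfl⟩; exact (abs_le.1 (hb w β u)).1⟩

end Model

/-! ### Particle systems -/

section Weighted

variable {S : Type*} [MeasurableSpace S] {N : ℕ}

lemma integral_weighted (ω : stdSimplex ℝ (Fin N)) (μ : Fin N → Measure S) {g : S → ℝ}
    (hg : ∀ i, Integrable g (μ i)) :
    ∫ x, g x ∂(weighted ω μ) = ∑ i, ω.1 i * ∫ x, g x ∂(μ i) := by
  rw [weighted, integral_finsetSum_measure fun i _ => (hg i).smul_measure ENNReal.ofReal_ne_top]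
  refine Finset.sum_congr rfl fun i _ => ?_
  rw [integral_smul_measure, ENNReal.toReal_ofReal (ω.2.1 i), smul_eq_mul]

lemma measurable_weighted {A : Type*} [MeasurableSpace A] {ω : A → stdSimplex ℝ (Fin N)}
    (hω : Measurable ω) {μ : A → Fin N → Measure S} (hμ : ∀ i, Measurable fun a => μ a i) :
    Measurable fun a => weighted (ω a) (μ a) := by
  refine Measure.measurable_of_measurable_coe _ fun s hs => ?_
  simp only [weighted, Measure.coe_finsetSum, Finset.sum_apply, Measure.smul_apply, smul_eq_mul]
  refine Finset.measurable_fun_sum _ fun i _ => Measurable.mul ?_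
    ((Measure.measurable_coe hs).comp (hμ i))
  exact ((measurable_pi_apply i).comp (measurable_subtype_coe.comp hω)).ennreal_ofReal

end Weighted

variable {n K : ℕ} {X : Set (EuclideanSpace ℝ (Fin n))} {N : ℕ}

lemma integral_particleBelief [CompactSpace X] (z : Particles K X N) {g : Fin K × X → ℝ}
    (hg : Continuous g) :
    ∫ p, g p ∂(particleBelief z : Measure (Fin K × X)) = ∑ i, z.2.1 i * g (z.1 i) := by
  have h : ((particleBelief z : Belief K X) : Measure (Fin K × X)) =
    weighted z.2 fun i => Measure.dirac (z.1 i) := rfl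
  rw [h, integral_weighted _ _ fun i => Model.integrable_of_continuous hg _]
  simp

lemma continuous_particleBelief [CompactSpace X] :
    Continuous (particleBelief : Particles K X N → Belief K X) := by
  refine ProbabilityMeasure.continuous_iff_forall_continuous_integral.2 fun g => ?_
  simp only [integral_particleBelief _ g.continuous]
  refine continuous_finsetSum _ fun i _ => ?_
  exact ((continuous_apply i).comp (continuous_subtype_val.comp continuous_snd)).mul
    (g.continuous.comp ((continuous_apply i).comp continuous_fst))

/-- Independent particles with bounded weights concentrate around their mean law, uniformly in
the laws and in the weights. -/
lemma exists_summable_tail [CompactSpace X] {V : Belief K X → ℝ} (hV : Continuous V) {ε : ℝ}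
    (hε : 0 < ε) (C : ℝ) (hC : 0 < C) :
    ∃ τ : ℕ → ℝ, (∀ N, 0 ≤ τ N) ∧ Summable τ ∧ ∀ (N : ℕ) (μ : Fin (N + 1) → Measure (Fin K × X))
      (_ : ∀ j, IsProbabilityMeasure (μ j)) (ω : stdSimplex ℝ (Fin (N + 1)))
      (_ : ∀ j, ω.1 j ≤ C / (N + 1 : ℕ)) (ν : Belief K X)
      (_ : ∀ g : Fin K × X → ℝ, Continuous g →
        ∑ j, ω.1 j * ∫ p, g p ∂(μ j) = ∫ p, g p ∂(ν : Measure (Fin K × X))),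
      ((Measure.pi μ).map fun x => (x, ω)).real
        {z | ε ≤ |V (particleBelief z) - V ν|} ≤ τ N := by
  obtain ⟨G, hG⟩ := exists_finset_integral_close hV hε
  -- One Hoeffding bound per test function, at deviation 1 as in `exists_finset_integral_close`;
  -- `‖g‖ + 1` is a bound of `g` that is positive even for `g = 0`.
  refine ⟨fun N => ∑ g ∈ G, 2 * Real.exp (-(1 ^ 2 / (2 * (‖g‖ + 1) ^ 2 * C) * (N + 1 : ℕ))),
    fun N => by positivity, summable_sum fun g _ => ?_, ?_⟩
  · have hc : 0 < 1 ^ 2 / (2 * (‖g‖ + 1) ^ 2 * C) := by positivity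
    have h := (Real.summable_exp_nat_mul_iff (a := -(1 ^ 2 / (2 * (‖g‖ + 1) ^ 2 * C)))).2
      (by linarith)
    refine Summable.mul_left 2 ?_
    refine ((summable_nat_add_iff 1).2 h).congr fun N => ?_
    congr 1
    ring
  · intro N μ hμ ω hω ν hν
    have hcl : IsClosed {z : Particles K X (N + 1) | ε ≤ |V (particleBelief z) - V ν|} :=
      isClosed_le continuous_const
        ((hV.comp continuous_particleBelief).sub continuous_const).abs
    rw [map_measureReal_apply (by fun_prop) hcl.measurableSet]
    -- If no test function deviates by 1, then `V` deviates by less than `ε`; a union bound over `G`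
    -- finishes.
    refine (measureReal_mono (s₂ := ⋃ g ∈ G, {x : Fin (N + 1) → Fin K × X |
      1 ≤ |∑ j, ω.1 j * g (x j) - ∑ j, ω.1 j * ∫ p, g p ∂(μ j)|})
      (fun x hx => ?_) (measure_ne_top _ _)).trans
      ((measureReal_biUnion_finset_le _ _).trans (Finset.sum_le_sum fun g _ => ?_))
    · by_contra hcon
      simp only [Set.mem_iUnion, Set.mem_ofPred_eq, exists_prop, not_exists, not_and, not_le]
        at hcon
      have hx' : ε ≤ |V (particleBelief (x, ω)) - V ν| := hx
      refine absurd (hG (particleBelief (x, ω)) ν fun g hg => ?_) (not_lt.2 hx')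
      rw [integral_particleBelief _ g.continuous, ← hν g g.continuous]
      exact (hcon g hg).le
    · exact measureReal_weighted_mean_ge_le μ ω hω g.continuous.measurable (by positivity)
        (fun x => (g.norm_coe_le_norm x).trans (by linarith)) zero_le_one

lemma measurableSet_weights_le (c : ℝ) :
    MeasurableSet {z : Particles K X N | ∀ i, z.2.1 i ≤ c} := by
  have : {z : Particles K X N | ∀ i, z.2.1 i ≤ c} = ⋂ i, {z | z.2.1 i ≤ c} := by
    ext z; simp
  rw [this]
  exact MeasurableSet.iInter fun i => measurableSet_le ((measurable_pi_apply i).comp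
    (measurable_subtype_coe.comp measurable_snd)) measurable_const

namespace Model

variable {d : ℕ} {W : Type*} [MeasurableSpace W]
  {M : Model n K d X W} {kLow kUp : ℕ → EuclideanSpace ℝ (Fin n) → ℝ}

/-! ### One step of the particle filter -/

lemma density_particleBelief [CompactSpace X] (hM : M.Regular kLow kUp) (t : ℕ)
    (z : Particles K X N) (u : M.U t) (y : EuclideanSpace ℝ (Fin n)) :
    M.density t (particleBelief z) u y =
      ∑ j, z.2.1 j * M.k t y (z.1 j).1 (z.1 j).2 (particleBelief z) u := by
  rw [density_eq_integral hM,
    integral_particleBelief z (M.continuous_density t (particleBelief z) u y)]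

lemma reweight_apply [CompactSpace X] (hM : M.Regular kLow kUp) (t : ℕ)
    (z : Particles K X N) (u : M.U t) (y : EuclideanSpace ℝ (Fin n)) (i : Fin N) :
    (M.reweight t z u y).1 i = z.2.1 i * M.k t y (z.1 i).1 (z.1 i).2 (particleBelief z) u /
      M.density t (particleBelief z) u y := by
  rw [density_particleBelief hM]
  rfl

/-- The mean of the propagated particles is the exact update of the particle belief. -/
lemma sum_reweight_mul_integral_move [CompactSpace X] (hM : M.Regular kLow kUp) (t : ℕ) (w : W)
    (z : Particles K X N) (u : M.U t) (y : EuclideanSpace ℝ (Fin n)) {g : Fin K × X → ℝ}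
    (hg : Continuous g) :
    ∑ i, (M.reweight t z u y).1 i * ∫ q, g q ∂(M.move w (z.1 i)) =
      ∫ q, g q ∂(M.update t w (particleBelief z) u y : Measure (Fin K × X)) := by
  rw [integral_update hM _ _ _ _ _ hg, integral_particleBelief z
    (g := fun p => M.k t y p.1 p.2 (particleBelief z) u * ∫ q, g q ∂(M.move w p))
    ((M.continuous_density t (particleBelief z) u y).mul (continuous_integral_move hM w hg)),
    Finset.mul_sum]
  refine Finset.sum_congr rfl fun i _ => ?_
  rw [reweight_apply hM]
  ring

/-- The likelihood is at most `kUp t y` and the normalising density at least `kLow t y`, whatever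
the system. -/
lemma reweight_le [CompactSpace X] (hM : M.Regular kLow kUp) (t : ℕ)
    (z : Particles K X N) (u : M.U t) (y : EuclideanSpace ℝ (Fin n)) {c : ℝ}
    (hz : ∀ i, z.2.1 i ≤ c) (i : Fin N) :
    (M.reweight t z u y).1 i ≤ c * kUp t y / kLow t y := by
  have h0 := z.2.2.1 i
  rw [reweight_apply hM]
  exact div_le_div₀ (mul_nonneg (h0.trans (hz i)) (kUp_pos hM t (particleBelief z) u y).le)
    (mul_le_mul (hz i) (hM.le_kUp _ _ _ _ _ _) (M.k_pos _ _ _ _ _ _).le (h0.trans (hz i)))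
    (hM.kLow_pos t y) (kLow_le_density hM t _ u y)

/-- One step of the filter consists of independent draws with deterministic weights; the mean law
is the exact update of the particle belief. -/
lemma exists_filterStep_eq [CompactSpace X] (hM : M.Regular kLow kUp) [NeZero N]
    (R : Resampling N) (t : ℕ) (w : W) (z : Particles K X N) (u : M.U t)
    (y : EuclideanSpace ℝ (Fin n)) {C C' : ℝ} (hz : ∀ i, z.2.1 i ≤ C / N) (h1 : 1 ≤ C')
    (hC' : C * kUp t y / kLow t y ≤ C') :
    ∃ (μ : Fin N → Measure (Fin K × X)) (ω : stdSimplex ℝ (Fin N)),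
      (∀ j, IsProbabilityMeasure (μ j)) ∧ (∀ j, ω.1 j ≤ C' / N) ∧
      M.filterStep R t w z u y = (Measure.pi μ).map (fun x => (x, ω)) ∧
      ∀ g : Fin K × X → ℝ, Continuous g → ∑ j, ω.1 j * ∫ p, g p ∂(μ j) =
        ∫ p, g p ∂(M.update t w (particleBelief z) u y : Measure (Fin K × X)) := by
  have hN : (0 : ℝ) < N := by exact_mod_cast Nat.pos_of_ne_zero (NeZero.ne N)
  by_cases h : R.score (M.reweight t z u y) < R.threshold
  · refine ⟨fun j => weighted (R.draw (M.reweight t z u y) j) fun i => M.move w (z.1 i),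
      uniformWeights N, fun j => inferInstance, fun j => ?_, ?_, fun g hg => ?_⟩
    · change (N : ℝ)⁻¹ ≤ C' / N
      rw [inv_eq_one_div]
      exact div_le_div_of_nonneg_right h1 hN.le
    · simp only [filterStep, h, if_true]
    · rw [← sum_reweight_mul_integral_move hM t w z u y hg]
      simp only [integral_weighted _ _ fun i => integrable_of_continuous hg (M.move w (z.1 i))]
      change ∑ j, (N : ℝ)⁻¹ * _ = _
      -- Only the average over slots matters: unbiasedness gives particle `i` total draw probability
      -- `N ω_i`, and the reset weight `1 / N` cancels the factor `N`.
      rw [← Finset.mul_sum, Finset.sum_comm]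
      simp only [← Finset.sum_mul, R.unbiased, mul_assoc]
      rw [← Finset.mul_sum, inv_mul_cancel_left₀ hN.ne']
  · refine ⟨fun i => M.move w (z.1 i), M.reweight t z u y, fun j => inferInstance, fun j => ?_,
      ?_, fun g hg => sum_reweight_mul_integral_move hM t w z u y hg⟩
    · refine (reweight_le hM t z u y hz j).trans ?_
      rw [div_mul_eq_mul_div, div_right_comm]
      exact div_le_div_of_nonneg_right hC' hN.le
    · simp only [filterStep, h, if_false]

instance [NeZero N] (R : Resampling N) (t : ℕ) (w : W) (z : Particles K X N) (u : M.U t)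
    (y : EuclideanSpace ℝ (Fin n)) : IsProbabilityMeasure (M.filterStep R t w z u y) := by
  simp only [filterStep]
  split_ifs
  all_goals exact Measure.isProbabilityMeasure_map (by fun_prop)

lemma ae_filterStep_le [CompactSpace X] (hM : M.Regular kLow kUp) [NeZero N]
    (R : Resampling N) (t : ℕ) (w : W) (z : Particles K X N) (u : M.U t)
    (y : EuclideanSpace ℝ (Fin n)) {C C' : ℝ} (hz : ∀ i, z.2.1 i ≤ C / N) (h1 : 1 ≤ C')
    (hC' : C * kUp t y / kLow t y ≤ C') :
    ∀ᵐ z' ∂(M.filterStep R t w z u y), ∀ i, z'.2.1 i ≤ C' / N := by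
  obtain ⟨μ, ω, hμ, hω, he, -⟩ := exists_filterStep_eq hM R t w z u y hz h1 hC'
  rw [he]
  exact (ae_map_iff (by fun_prop) (measurableSet_weights_le _)).2 (Eventually.of_forall fun _ => hω)

/-- The law of the next particle system, given the updated weights and the particles. -/
def stepLaw (M : Model n K d X W) [NeZero N] (R : Resampling N) (w : W)
    (q : stdSimplex ℝ (Fin N) × (Fin N → Fin K × X)) : Measure (Particles K X N) :=
  {q : stdSimplex ℝ (Fin N) × (Fin N → Fin K × X) | R.score q.1 < R.threshold}.piecewise
    (fun q => (Measure.pi fun j => weighted (R.draw q.1 j) fun i => M.move w (q.2 i)).map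
      fun x => (x, uniformWeights N))
    (fun q => (Measure.pi fun i => M.move w (q.2 i)).map fun x => (x, q.1)) q

lemma filterStep_eq_stepLaw [NeZero N] (R : Resampling N) (t : ℕ) (w : W) (z : Particles K X N)
    (u : M.U t) (y : EuclideanSpace ℝ (Fin n)) :
    M.filterStep R t w z u y = M.stepLaw R w (M.reweight t z u y, z.1) := by
  by_cases h : R.score (M.reweight t z u y) < R.threshold
  · simp [filterStep, stepLaw, Set.piecewise, h]
  · simp [filterStep, stepLaw, Set.piecewise, h]

lemma measurable_map_prodMk {A S : Type*} [MeasurableSpace A] [MeasurableSpace S]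
    {κ : A → Measure S} [∀ a, IsProbabilityMeasure (κ a)] (hκ : Measurable κ)
    {T : Type*} [MeasurableSpace T] {f : A → T} (hf : Measurable f) :
    Measurable fun a => (κ a).map fun x => (x, f a) := by
  let η : Kernel A S := ⟨κ, hκ⟩
  have : IsMarkovKernel η := ⟨fun a => by change IsProbabilityMeasure (κ a); infer_instance⟩
  have h : ∀ a, (η ×ₖ Kernel.deterministic f hf) a = (κ a).map fun x => (x, f a) := fun a => by
    rw [Kernel.prod_apply, Kernel.deterministic_apply, Measure.prod_dirac]
    rfl
  simp only [← h]
  exact Kernel.measurable _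

/-- The step depends on the data only through the updated weights and the positions, so
measurability in `y` and in the system both follow from this by composition. -/
lemma measurable_stepLaw [NeZero N] (R : Resampling N) (w : W) : Measurable (M.stepLaw R w) := by
  have hmove : ∀ i, Measurable fun q : stdSimplex ℝ (Fin N) × (Fin N → Fin K × X) =>
      M.move w (q.2 i) := fun i =>
    (M.move w).measurable.comp ((measurable_pi_apply i).comp measurable_snd)
  refine Measurable.piecewise
    (measurableSet_lt (R.score_measurable.comp measurable_fst) measurable_const) ?_ ?_
  · exact measurable_map_prodMk (measurable_measure_pi
      (κ := fun j (q : stdSimplex ℝ (Fin N) × (Fin N → Fin K × X)) =>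
        weighted (R.draw q.1 j) fun i => M.move w (q.2 i)) fun j =>
      measurable_weighted ((R.draw_measurable j).comp measurable_fst) hmove) measurable_const
  · exact measurable_map_prodMk (measurable_measure_pi
      (κ := fun i (q : stdSimplex ℝ (Fin N) × (Fin N → Fin K × X)) => M.move w (q.2 i)) hmove)
      measurable_fst

lemma measurable_filterStep_right [NeZero N]
    (R : Resampling N) (t : ℕ) (w : W) (z : Particles K X N) (u : M.U t) :
    Measurable fun y => M.filterStep R t w z u y := by
  simp only [filterStep_eq_stepLaw]
  refine (measurable_stepLaw R w).comp (Measurable.prodMk ?_ measurable_const)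
  refine Measurable.subtype_mk (measurable_pi_iff.2 fun i => ?_)
  exact ((M.k_measurable t _ _ _ _).const_mul _).div
    (Finset.measurable_fun_sum _ fun j _ => (M.k_measurable t _ _ _ _).const_mul _)

lemma measurable_filterStep_left [CompactSpace X] (hM : M.Regular kLow kUp) [NeZero N]
    (R : Resampling N) (t : ℕ) (w : W) (u : M.U t) (y : EuclideanSpace ℝ (Fin n)) :
    Measurable fun z => M.filterStep R t w z u y := by
  simp only [filterStep_eq_stepLaw]
  refine (measurable_stepLaw R w).comp (Measurable.prodMk ?_ measurable_fst)
  refine Measurable.subtype_mk (measurable_pi_iff.2 fun i => ?_)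
  have hk : ∀ j, Measurable fun z : Particles K X N =>
      z.2.1 j * M.k t y (z.1 j).1 (z.1 j).2 (particleBelief z) u := fun j => by
    refine Continuous.measurable (Continuous.mul
      ((continuous_apply j).comp (continuous_subtype_val.comp continuous_snd)) ?_)
    exact (continuous_k hM t y).comp (((continuous_apply j).comp continuous_fst).prodMk
      (continuous_particleBelief.prodMk continuous_const))
  exact (hk i).div (Finset.measurable_fun_sum _ fun j _ => hk j)

/-! ### Consistency of the particle filter -/

lemma isProbabilityMeasure_filterLaw [CompactSpace X] (hM : M.Regular kLow kUp) [NeZero N]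
    (R : Resampling N) (β₁ : Belief K X) (w : ℕ → W) (u : (s : ℕ) → M.U s)
    (y : ℕ → EuclideanSpace ℝ (Fin n)) :
    ∀ s, IsProbabilityMeasure (M.filterLaw R β₁ w u y s)
  | 0 => Measure.isProbabilityMeasure_map (by fun_prop)
  | 1 => Measure.isProbabilityMeasure_map (by fun_prop)
  | s + 2 => by
    have := isProbabilityMeasure_filterLaw hM R β₁ w u y (s + 1)
    exact isProbabilityMeasure_bind (measurable_filterStep_left hM R _ _ _ _).aemeasurable
      (Eventually.of_forall fun z => inferInstance)

lemma isClosed_particleBelief_notMem [CompactSpace X] {O : Set (Belief K X)} (hO : IsOpen O) :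
    IsClosed {z : Particles K X N | particleBelief z ∉ O} :=
  hO.isClosed_compl.preimage continuous_particleBelief

/-- A continuous function that separates a belief from the complement of a neighbourhood. -/
lemma exists_continuous_separating [CompactSpace X] {O : Set (Belief K X)} (hO : IsOpen O)
    {β : Belief K X} (hβ : β ∈ O) :
    ∃ V : Belief K X → ℝ, Continuous V ∧ V β = 0 ∧ ∀ β' ∉ O, V β' = 1 := by
  obtain ⟨V, h0, h1, -⟩ := exists_continuous_zero_one_of_isClosed (isClosed_singleton (x := β))
    hO.isClosed_compl (Set.disjoint_left.2 fun x hx hx' => hx' (by rw [hx]; exact hβ))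
  exact ⟨V, V.continuous, h0 rfl, fun β' h => h1 h⟩

/-- Along a fixed history the weights of the particle filter with `N + 1` particles are of order
`1 / (N + 1)`. -/
lemma exists_ae_weights_le [CompactSpace X] (hM : M.Regular kLow kUp)
    (R : (N : ℕ) → Resampling (N + 1)) (β₁ : Belief K X) (w : ℕ → W) (u : (s : ℕ) → M.U s)
    (y : ℕ → EuclideanSpace ℝ (Fin n)) (s : ℕ) :
    ∃ C : ℝ, ∀ N, ∀ᵐ z ∂(M.filterLaw (R N) β₁ w u y (s + 1)), ∀ i, z.2.1 i ≤ C / (N + 1 : ℕ) := by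
  induction s with
  | zero =>
    refine ⟨1, fun N => (ae_map_iff (by fun_prop) (measurableSet_weights_le _)).2
      (Eventually.of_forall fun x i => ?_)⟩
    change ((N + 1 : ℕ) : ℝ)⁻¹ ≤ 1 / (N + 1 : ℕ)
    rw [inv_eq_one_div]
  | succ s ih =>
    obtain ⟨C, hC⟩ := ih
    -- The 1 covers weights reset by resampling, the other term weights that were only updated.
    set C' := max 1 (C * kUp (s + 1) (y (s + 1)) / kLow (s + 1) (y (s + 1)))
    refine ⟨C', fun N => ?_⟩
    have hm := measurable_filterStep_left hM (R N) (s + 1) (w (s + 1)) (u (s + 1)) (y (s + 1))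
    rw [filterLaw, ae_iff, ← Set.compl_ofPred,
      Measure.bind_apply (measurableSet_weights_le _).compl hm.aemeasurable]
    refine (lintegral_congr_ae ?_).trans lintegral_zero
    filter_upwards [hC N] with z hz
    exact ae_iff.1 (ae_filterStep_le hM (R N) (s + 1) (w (s + 1)) z (u (s + 1)) (y (s + 1)) hz
      (le_max_left _ _) (le_max_right _ _))

/-- Along a fixed history the particle belief leaves every neighbourhood of the exact belief with
summable probability. -/
lemma tsum_filterLaw_ne_top [CompactSpace X] (hM : M.Regular kLow kUp)
    (R : (N : ℕ) → Resampling (N + 1)) (β₁ : Belief K X) (w : ℕ → W) (u : (s : ℕ) → M.U s)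
    (y : ℕ → EuclideanSpace ℝ (Fin n)) (s : ℕ) {O : Set (Belief K X)} (hO : IsOpen O)
    (hβ : M.beliefAt β₁ w u y (s + 1) ∈ O) :
    ∑' N, M.filterLaw (R N) β₁ w u y (s + 1) {z | particleBelief z ∉ O} ≠ ∞ := by
  induction s generalizing O with
  | zero =>
    -- `V` vanishes at the exact belief and equals 1 off `O`, so leaving `O` forces a deviation of
    -- at least `1 / 2`.
    obtain ⟨V, hV, hV0, hV1⟩ := exists_continuous_separating hO hβ
    obtain ⟨τ, -, hτ, h⟩ := exists_summable_tail hV (ε := 1 / 2) (by norm_num) 1 one_pos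
    refine ne_top_of_le_ne_top hτ.tsum_ofReal_ne_top (ENNReal.tsum_le_tsum fun N => ?_)
    have hprob := isProbabilityMeasure_filterLaw hM (R N) β₁ w u y 1
    rw [← ofReal_measureReal]
    refine ENNReal.ofReal_le_ofReal ((measureReal_mono fun z hz => ?_).trans
      (h N (fun _ => β₁) (fun _ => inferInstance) (uniformWeights (N + 1)) (fun j => ?_) β₁
        fun g hg => ?_))
    · have h1 := hV1 _ hz
      have h0 : V β₁ = 0 := hV0
      change 1 / 2 ≤ |V (particleBelief z) - V β₁|
      rw [h1, h0]
      norm_num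
    · change ((N + 1 : ℕ) : ℝ)⁻¹ ≤ 1 / (N + 1 : ℕ)
      rw [inv_eq_one_div]
    · rw [← Finset.sum_mul, (uniformWeights (N + 1)).2.2, one_mul]
  | succ s ih =>
    set Φ : Belief K X → Belief K X :=
      fun β => M.update (s + 1) (w (s + 1)) β (u (s + 1)) (y (s + 1))
    have hΦc : Continuous Φ := by
      have hu : Continuous fun β : Belief K X => (β, u (s + 1)) := by fun_prop
      have h := (continuous_update hM (s + 1) (w (s + 1)) (y (s + 1))).comp hu
      exact h
    obtain ⟨V, hV, hV0, hV1⟩ := exists_continuous_separating hO hβ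
    obtain ⟨C, hC⟩ := exists_ae_weights_le hM R β₁ w u y s
    set C' := max 1 (C * kUp (s + 1) (y (s + 1)) / kLow (s + 1) (y (s + 1)))
    obtain ⟨τ, -, hτ, h⟩ := exists_summable_tail hV (ε := 1 / 2) (by norm_num) C'
      (one_pos.trans_le (le_max_left _ _))
    -- Leaving `O` requires either that the previous particle belief lay outside this neighbourhood
    -- of the previous exact belief, which the induction hypothesis controls, or that the step
    -- deviated by `1 / 2` from its mean, which has probability at most `τ N`.
    have hO' : IsOpen {β | V (Φ β) < 1 / 2} := isOpen_lt (hV.comp hΦc) continuous_const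
    have hsum := ih hO' (by
      change V (M.beliefAt β₁ w u y (s + 1 + 1)) < 1 / 2
      rw [hV0]; norm_num)
    have hsum' : ∑' N, (M.filterLaw (R N) β₁ w u y (s + 1)
        {z | particleBelief z ∉ {β | V (Φ β) < 1 / 2}} + ENNReal.ofReal (τ N)) ≠ ∞ := by
      rw [ENNReal.tsum_add]
      exact ENNReal.add_ne_top.2 ⟨hsum, hτ.tsum_ofReal_ne_top⟩
    refine ne_top_of_le_ne_top hsum' (ENNReal.tsum_le_tsum fun N => ?_)
    have hprob := isProbabilityMeasure_filterLaw hM (R N) β₁ w u y (s + 1)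
    have hm := measurable_filterStep_left hM (R N) (s + 1) (w (s + 1)) (u (s + 1)) (y (s + 1))
    rw [filterLaw, Measure.bind_apply (isClosed_particleBelief_notMem hO).measurableSet
      hm.aemeasurable]
    have hA := (isClosed_particleBelief_notMem (N := N + 1) hO').measurableSet
    calc _ ≤ ∫⁻ z, ({z | particleBelief z ∉ {β | V (Φ β) < 1 / 2}}.indicator 1 z +
          ENNReal.ofReal (τ N)) ∂(M.filterLaw (R N) β₁ w u y (s + 1)) := ?_
      _ = _ := by
        rw [lintegral_add_right _ measurable_const, lintegral_indicator_one hA, lintegral_const,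
          measure_univ, mul_one]
    refine lintegral_mono_ae ?_
    filter_upwards [hC N] with z hz
    by_cases hzO : V (Φ (particleBelief z)) < 1 / 2
    · refine le_add_left ?_
      obtain ⟨μ, ω, hμ, hω, he, hmean⟩ := exists_filterStep_eq hM (R N) (s + 1) (w (s + 1)) z
        (u (s + 1)) (y (s + 1)) hz (le_max_left _ _) (le_max_right _ _)
      rw [← ofReal_measureReal]
      refine ENNReal.ofReal_le_ofReal ((measureReal_mono (fun z' hz' => ?_)
        (measure_ne_top _ _)).trans ((congrArg (fun ν : Measure _ => ν.real _) he).le.trans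
          (h N μ hμ ω hω (Φ (particleBelief z)) hmean)))
      have h1 := hV1 _ hz'
      change 1 / 2 ≤ |V (particleBelief z') - V (Φ (particleBelief z))|
      rw [h1]
      exact le_abs.2 (Or.inl (by linarith))
    · refine le_add_right (prob_le_one.trans ?_)
      rw [Set.indicator_of_mem (by exact hzO)]
      rfl

/-- Along a fixed history the particle beliefs converge weakly to the exact belief, almost surely,
whatever the joint law of the filters. -/
lemma ae_tendsto_particleBelief [CompactSpace X] (hM : M.Regular kLow kUp)
    (R : (N : ℕ) → Resampling (N + 1)) (β₁ : Belief K X) (w : ℕ → W) (u : (s : ℕ) → M.U s)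
    (y : ℕ → EuclideanSpace ℝ (Fin n)) (s : ℕ) {Ω : Type*} [MeasurableSpace Ω] {P : Measure Ω}
    {Z : (N : ℕ) → Ω → Particles K X (N + 1)}
    (hZ : ∀ N, HasLaw (Z N) (M.filterLaw (R N) β₁ w u y (s + 1)) P) :
    ∀ᵐ ω ∂P, Tendsto (fun N => particleBelief (Z N ω)) atTop
      (𝓝 (M.beliefAt β₁ w u y (s + 1))) := by
  -- A countable neighbourhood basis leaves only countably many exceptional null sets.
  obtain ⟨O, hO, hbasis⟩ :=
    (nhds_basis_opens (M.beliefAt β₁ w u y (s + 1))).exists_antitone_subbasis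
  have h : ∀ k, ∀ᵐ ω ∂P, ∀ᶠ N in atTop, ¬ particleBelief (Z N ω) ∉ O k := fun k => by
    -- The convergence half of Borel–Cantelli uses the marginal laws alone, so no independence
    -- between filters is required.
    refine ae_eventually_notMem (s := fun N => {ω | particleBelief (Z N ω) ∉ O k}) ?_
    have := tsum_filterLaw_ne_top hM R β₁ w u y s (hO k).2 (hO k).1
    convert this using 3 with N
    exact (hZ N).measure_eq (isClosed_particleBelief_notMem (hO k).2).measurableSet
  filter_upwards [ae_all_iff.2 h] with ω hω
  exact hbasis.toHasBasis.tendsto_right_iff.2 fun k _ => (hω k).mono fun N => not_not.1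

/-- The random particle systems have weights of order `1 / (N + 1)`, almost surely. -/
lemma exists_ae_forall_weights_le [CompactSpace X] (hM : M.Regular kLow kUp)
    (R : (N : ℕ) → Resampling (N + 1)) (β₁ : Belief K X) (w : ℕ → W) (u : (s : ℕ) → M.U s)
    (y : ℕ → EuclideanSpace ℝ (Fin n)) (s : ℕ) {Ω : Type*} [MeasurableSpace Ω] {P : Measure Ω}
    {Z : (N : ℕ) → Ω → Particles K X (N + 1)}
    (hZ : ∀ N, HasLaw (Z N) (M.filterLaw (R N) β₁ w u y (s + 1)) P) :
    ∃ C : ℝ, ∀ᵐ ω ∂P, ∀ N i, (Z N ω).2.1 i ≤ C / (N + 1 : ℕ) := by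
  obtain ⟨C, hC⟩ := exists_ae_weights_le hM R β₁ w u y s
  refine ⟨C, ae_all_iff.2 fun N => ?_⟩
  have h := hC N
  rw [← (hZ N).map_eq] at h
  exact ae_of_ae_map (hZ N).aemeasurable h

/-! ### Comparison of the particle values with the exact values -/

/-- After one step of the filter the value of the particle belief is close in mean to the value of
the exact update, uniformly in the particle system and in the decision variable. -/
lemma eventually_integral_abs_sub_le [CompactSpace X] (hM : M.Regular kLow kUp)
    (R : (N : ℕ) → Resampling (N + 1)) {V : Belief K X → ℝ} (hV : Continuous V) {B : ℝ}
    (hB : ∀ β, |V β| ≤ B) (t : ℕ) (w : W) (y : EuclideanSpace ℝ (Fin n)) (C : ℝ) {ε : ℝ}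
    (hε : 0 < ε) :
    ∀ᶠ N in atTop, ∀ (z : Particles K X (N + 1)) (u : M.U t),
      (∀ i, z.2.1 i ≤ C / (N + 1 : ℕ)) →
        ∫ z', |V (particleBelief z') - V (M.update t w (particleBelief z) u y)|
          ∂(M.filterStep (R N) t w z u y) ≤ ε := by
  set C' := max 1 (C * kUp t y / kLow t y)
  obtain ⟨τ, -, hτ, h⟩ := exists_summable_tail hV (half_pos hε) C'
    (one_pos.trans_le (le_max_left _ _))
  have hlim : Tendsto (fun N => 2 * B * τ N) atTop (𝓝 0) := by
    simpa using hτ.tendsto_atTop_zero.const_mul (2 * B)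
  filter_upwards [hlim.eventually_lt_const (half_pos hε)] with N hN z u hz
  obtain ⟨μ, ω, hμ, hω, he, hmean⟩ := exists_filterStep_eq hM (R N) t w z u y hz
    (le_max_left _ _) (le_max_right _ _)
  set ν := M.update t w (particleBelief z) u y
  have htail := h N μ hμ ω hω ν hmean
  rw [← he] at htail
  set A := {z' : Particles K X (N + 1) | ε / 2 ≤ |V (particleBelief z') - V ν|}
  have hcont : Continuous fun z' : Particles K X (N + 1) => |V (particleBelief z') - V ν| :=
    ((hV.comp continuous_particleBelief).sub continuous_const).abs
  have hAm : MeasurableSet A := (isClosed_le continuous_const hcont).measurableSet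
  have hB0 : 0 ≤ B := (abs_nonneg _).trans (hB ν)
  -- Off `A` the deviation is below `ε / 2`; on `A`, of probability at most `τ N`, it is at most `2
  -- * B`.
  have hle : ∀ z' : Particles K X (N + 1),
      |V (particleBelief z') - V ν| ≤ ε / 2 + A.indicator (fun _ => 2 * B) z' := by
    intro z'
    by_cases hz' : z' ∈ A
    · rw [Set.indicator_of_mem hz']
      have := (abs_sub (V (particleBelief z')) (V ν)).trans (add_le_add (hB _) (hB _))
      linarith
    · rw [Set.indicator_of_notMem hz', add_zero]
      exact (not_le.1 hz').le
  have hind : Integrable (A.indicator fun _ => 2 * B) (M.filterStep (R N) t w z u y) :=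
    (integrable_const _).indicator hAm
  calc _ ≤ ∫ z', (ε / 2 + A.indicator (fun _ => 2 * B) z') ∂(M.filterStep (R N) t w z u y) :=
        integral_mono_of_nonneg (Eventually.of_forall fun _ => abs_nonneg _)
          ((integrable_const _).add hind) (Eventually.of_forall hle)
    _ = ε / 2 + (M.filterStep (R N) t w z u y).real A * (2 * B) := by
        rw [integral_add (integrable_const _) hind, integral_indicator_const _ hAm]
        simp
    _ ≤ ε := by nlinarith

lemma measurable_ext_prod_filterStep [NeZero N] (R : Resampling N) (t : ℕ) (w : W)
    (z : Particles K X N) (u : M.U t) :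
    Measurable fun y => (M.ext (w, y)).prod (M.filterStep R t w z u y) := by
  let κ : Kernel (EuclideanSpace ℝ (Fin n)) W :=
    M.ext.comap (fun y => (w, y)) measurable_prodMk_left
  let η : Kernel (EuclideanSpace ℝ (Fin n)) (Particles K X N) :=
    ⟨fun y => M.filterStep R t w z u y, measurable_filterStep_right R t w z u⟩
  have : IsMarkovKernel η :=
    ⟨fun y => by change IsProbabilityMeasure (M.filterStep R t w z u y); infer_instance⟩
  have h : ∀ y, (κ ×ₖ η) y = (M.ext (w, y)).prod (M.filterStep R t w z u y) := fun y =>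
    Kernel.prod_apply _ _ _
  simp only [← h]
  exact Kernel.measurable _

lemma isProbabilityMeasure_withDensity_density [CompactSpace X] (hM : M.Regular kLow kUp) (t : ℕ)
    (β : Belief K X) (u : M.U t) :
    IsProbabilityMeasure ((volume : Measure (EuclideanSpace ℝ (Fin n))).withDensity
      fun y => ENNReal.ofReal (M.density t β u y)) :=
  ⟨by rw [withDensity_apply _ MeasurableSet.univ, Measure.restrict_univ, lintegral_density hM]⟩

lemma isProbabilityMeasure_nextLaw [CompactSpace X] (hM : M.Regular kLow kUp) [NeZero N]
    (R : Resampling N) (t : ℕ) (w : W) (z : Particles K X N) (u : M.U t) :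
    IsProbabilityMeasure (M.nextLaw R t w z u) := by
  have := isProbabilityMeasure_withDensity_density hM t (particleBelief z) u
  exact isProbabilityMeasure_bind (measurable_ext_prod_filterStep R t w z u).aemeasurable
    (Eventually.of_forall fun y => inferInstance)

lemma integrable_density_mul_of_nextLaw [CompactSpace X] (hM : M.Regular kLow kUp) [NeZero N]
    (R : Resampling N) (t : ℕ) (w : W) (z : Particles K X N) (u : M.U t)
    {f : W × Particles K X N → ℝ} (hf : Integrable f (M.nextLaw R t w z u)) :
    Integrable fun y => M.density t (particleBelief z) u y *
      ∫ q, f q ∂((M.ext (w, y)).prod (M.filterStep R t w z u y)) := by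
  have := isProbabilityMeasure_withDensity_density hM t (particleBelief z) u
  have h := integrable_integral_bind (measurable_ext_prod_filterStep R t w z u) hf
  rw [integrable_withDensity_iff_integrable_smul' (measurable_density hM t _ u).ennreal_ofReal
    (Eventually.of_forall fun y => ENNReal.ofReal_lt_top)] at h
  simpa only [ENNReal.toReal_ofReal (density_pos hM t (particleBelief z) u _).le, smul_eq_mul]
    using h

lemma integral_nextLaw [CompactSpace X] (hM : M.Regular kLow kUp) [NeZero N]
    (R : Resampling N) (t : ℕ) (w : W) (z : Particles K X N) (u : M.U t)
    {f : W × Particles K X N → ℝ} (hf : Integrable f (M.nextLaw R t w z u)) :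
    ∫ q, f q ∂(M.nextLaw R t w z u) = ∫ y, M.density t (particleBelief z) u y *
      ∫ q, f q ∂((M.ext (w, y)).prod (M.filterStep R t w z u y)) := by
  have := isProbabilityMeasure_withDensity_density hM t (particleBelief z) u
  refine (integral_bind_eq (measurable_ext_prod_filterStep R t w z u) hf).trans ?_
  rw [integral_withDensity_eq_integral_toReal_smul (measurable_density hM t _ u).ennreal_ofReal
    (Eventually.of_forall fun y => ENNReal.ofReal_lt_top)]
  simp only [ENNReal.toReal_ofReal (density_pos hM t (particleBelief z) u _).le, smul_eq_mul]

/-- The density of the released data is positive everywhere, so "almost every `y`" under its law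
means Lebesgue almost every. Measurability descends from the mixture, and the bound restores
integrability. -/
lemma ae_integrable_of_nextLaw [CompactSpace X] (hM : M.Regular kLow kUp) [NeZero N]
    (R : Resampling N) (t : ℕ) (w : W) (z : Particles K X N) (u : M.U t)
    {f : W × Particles K X N → ℝ} (hf : Integrable f (M.nextLaw R t w z u)) {B : ℝ}
    (hB : ∀ q, |f q| ≤ B) :
    ∀ᵐ y, Integrable f ((M.ext (w, y)).prod (M.filterStep R t w z u y)) := by
  have h := AEMeasurable.ae_of_bind (measurable_ext_prod_filterStep R t w z u).aemeasurable
    hf.aemeasurable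
  rw [ae_withDensity_iff (measurable_density hM t _ u).ennreal_ofReal] at h
  filter_upwards [h] with y hy
  have hy' := hy (by simpa using density_pos hM t (particleBelief z) u y)
  exact Integrable.of_bound hy'.aestronglyMeasurable B (Eventually.of_forall hB)

/-- Convergence of the expected particle value, for fixed released data. -/
lemma tendsto_integral_prod_sub [CompactSpace X] (hM : M.Regular kLow kUp)
    (R : (N : ℕ) → Resampling (N + 1)) {V : W → Belief K X → ℝ} (hV : RegularValue V)
    {VN : (N : ℕ) → W → Particles K X (N + 1) → ℝ} {B : ℝ} (hB : ∀ N w z, |VN N w z| ≤ B)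
    (hcmp : ∀ (w : W) (C ε : ℝ), 0 < ε → ∀ᶠ N in atTop, ∀ z : Particles K X (N + 1),
      (∀ i, z.2.1 i ≤ C / (N + 1 : ℕ)) → |VN N w z - V w (particleBelief z)| ≤ ε)
    (t : ℕ) (w : W) (y : EuclideanSpace ℝ (Fin n)) {C : ℝ} {φ : ℕ → ℕ} (hφ : StrictMono φ)
    (z : (j : ℕ) → Particles K X (φ j + 1)) (hz : ∀ j i, (z j).2.1 i ≤ C / (φ j + 1 : ℕ))
    (u : ℕ → M.U t)
    (hint : ∀ j, Integrable (fun q : W × Particles K X (φ j + 1) => VN (φ j) q.1 q.2)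
      ((M.ext (w, y)).prod (M.filterStep (R (φ j)) t w (z j) (u j) y))) :
    Tendsto (fun j => (∫ q, VN (φ j) q.1 q.2
        ∂((M.ext (w, y)).prod (M.filterStep (R (φ j)) t w (z j) (u j) y))) -
      ∫ w', V w' (M.update t w (particleBelief (z j)) (u j) y) ∂(M.ext (w, y))) atTop (𝓝 0) := by
  obtain ⟨B', hB'⟩ := hV.bounded
  set ν : ℕ → Belief K X := fun j => M.update t w (particleBelief (z j)) (u j) y
  have hVi : ∀ j, Integrable (fun w' => V w' (ν j)) (M.ext (w, y)) := fun j =>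
    Integrable.of_bound (hV.measurable _).aestronglyMeasurable B'
      (Eventually.of_forall fun w' => hB' w' _)
  have hdiff : ∀ j, (∫ q, VN (φ j) q.1 q.2
        ∂((M.ext (w, y)).prod (M.filterStep (R (φ j)) t w (z j) (u j) y))) -
      ∫ w', V w' (ν j) ∂(M.ext (w, y)) =
      ∫ w', ((∫ z', VN (φ j) w' z' ∂(M.filterStep (R (φ j)) t w (z j) (u j) y)) - V w' (ν j))
        ∂(M.ext (w, y)) := fun j => by
    rw [integral_prod _ (hint j), integral_sub (hint j).integral_prod_left (hVi j)]
  refine Tendsto.congr (fun j => (hdiff j).symm) ?_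
  have hlim := tendsto_integral_of_dominated_convergence (μ := M.ext (w, y))
    (F := fun j w' => (∫ z', VN (φ j) w' z'
      ∂(M.filterStep (R (φ j)) t w (z j) (u j) y)) - V w' (ν j)) (f := fun _ => 0)
    (fun _ => B + B') (fun j => ((hint j).integral_prod_left.sub (hVi j)).aestronglyMeasurable)
    (integrable_const _) (fun j => Eventually.of_forall fun w' => ?_) ?_
  · simpa using hlim
  · exact (abs_sub _ _).trans (add_le_add (abs_integral_le_of_abs_le fun z' => hB _ _ _) (hB' _ _))
  · filter_upwards [ae_all_iff.2 fun j => (hint j).prod_right_ae] with w' hw'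
    rw [Metric.tendsto_atTop']
    intro ε hε
    -- The systems after the step satisfy the weight bound with this constant, which depends on `y`
    -- but not on `j`; the comparison hypothesis is invoked with it.
    set C' := max 1 (C * kUp t y / kLow t y)
    have e1 := hφ.tendsto_atTop.eventually (hcmp w' C' (ε / 4) (by positivity))
    have e2 := hφ.tendsto_atTop.eventually (eventually_integral_abs_sub_le hM R
      (hV.continuous w') (hB' w') t w y C (ε := ε / 4) (by positivity))
    obtain ⟨J, hJ⟩ := eventually_atTop.1 (e1.and e2)
    refine ⟨J, fun j hj => ?_⟩
    obtain ⟨h1, h2⟩ := hJ j hj.le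
    set m := M.filterStep (R (φ j)) t w (z j) (u j) y
    have hVc : Integrable (fun z' => V w' (particleBelief z') - V w' (ν j)) m :=
      Integrable.of_bound (((hV.continuous w').comp continuous_particleBelief).sub
        continuous_const).measurable.aestronglyMeasurable (B' + B')
        (Eventually.of_forall fun z' => (abs_sub _ _).trans (add_le_add (hB' _ _) (hB' _ _)))
    have hVd : Integrable (fun z' => VN (φ j) w' z' - V w' (particleBelief z')) m :=
      (hw' j).sub (Integrable.of_bound ((hV.continuous w').comp
        continuous_particleBelief).measurable.aestronglyMeasurable B'
        (Eventually.of_forall fun z' => hB' _ _))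
    -- The comparison error at the new system, plus the fluctuation of `V` around the exact update.
    have hsplit : (∫ z', VN (φ j) w' z' ∂m) - V w' (ν j) =
        (∫ z', (VN (φ j) w' z' - V w' (particleBelief z')) ∂m) +
          ∫ z', (V w' (particleBelief z') - V w' (ν j)) ∂m := by
      rw [← integral_add hVd hVc]
      have : ∀ z', VN (φ j) w' z' - V w' (particleBelief z') +
          (V w' (particleBelief z') - V w' (ν j)) = VN (φ j) w' z' - V w' (ν j) := fun z' => by ring
      simp only [this]
      rw [integral_sub (hw' j) (integrable_const _), integral_const, probReal_univ, one_smul]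
    have b1 : |∫ z', (VN (φ j) w' z' - V w' (particleBelief z')) ∂m| ≤ ε / 4 := by
      have hae := ae_filterStep_le hM (R (φ j)) t w (z j) (u j) y (hz j)
        (le_max_left _ _) (le_max_right _ _)
      have := norm_integral_le_of_norm_le_const (μ := m)
        (f := fun z' => VN (φ j) w' z' - V w' (particleBelief z')) (C := ε / 4)
        (hae.mono fun z' hz' => h1 z' hz')
      simpa using this
    have b2 : |∫ z', (V w' (particleBelief z') - V w' (ν j)) ∂m| ≤ ε / 4 :=
      abs_integral_le_integral_abs.trans (h2 (z j) (u j) (hz j))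
    rw [Real.dist_eq, sub_zero, hsplit]
    have := abs_add_le (∫ z', (VN (φ j) w' z' - V w' (particleBelief z')) ∂m)
      (∫ z', (V w' (particleBelief z') - V w' (ν j)) ∂m)
    linarith

/-- The expected particle value at the next time is close to the expected exact value, uniformly
in the particle system and in the decision variable. -/
lemma eventually_abs_integral_nextLaw_sub_le [CompactSpace X] (hM : M.Regular kLow kUp)
    (R : (N : ℕ) → Resampling (N + 1)) {V : W → Belief K X → ℝ} (hV : RegularValue V)
    {VN : (N : ℕ) → W → Particles K X (N + 1) → ℝ} {B : ℝ} (hB : ∀ N w z, |VN N w z| ≤ B)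
    (hcmp : ∀ (w : W) (C ε : ℝ), 0 < ε → ∀ᶠ N in atTop, ∀ z : Particles K X (N + 1),
      (∀ i, z.2.1 i ≤ C / (N + 1 : ℕ)) → |VN N w z - V w (particleBelief z)| ≤ ε)
    (t : ℕ) (hint : ∀ N w (z : Particles K X (N + 1)) (u : M.U t),
      Integrable (fun q : W × Particles K X (N + 1) => VN N q.1 q.2) (M.nextLaw (R N) t w z u))
    (w : W) (C : ℝ) {ε : ℝ} (hε : 0 < ε) :
    ∀ᶠ N in atTop, ∀ (z : Particles K X (N + 1)), (∀ i, z.2.1 i ≤ C / (N + 1 : ℕ)) →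
      ∀ u : M.U t, |(∫ q, VN N q.1 q.2 ∂(M.nextLaw (R N) t w z u)) -
        M.nextMean V t w (particleBelief z) u| ≤ ε := by
  -- Failure of uniformity produces a subsequence of systems and decisions with error above `ε`;
  -- along it dominated convergence applies, although the bounds are only pointwise in `y` and the
  -- next input.
  by_contra hcon
  obtain ⟨φ, hφ, hbad⟩ := Filter.extraction_of_frequently_atTop (not_eventually.1 hcon)
  simp only [not_forall, not_le] at hbad
  choose z hz u hlt using hbad
  obtain ⟨B', hB'⟩ := hV.bounded
  set A : ℕ → EuclideanSpace ℝ (Fin n) → ℝ := fun j y => ∫ q, VN (φ j) q.1 q.2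
    ∂((M.ext (w, y)).prod (M.filterStep (R (φ j)) t w (z j) (u j) y))
  set D : ℕ → EuclideanSpace ℝ (Fin n) → ℝ := fun j y =>
    ∫ w', V w' (M.update t w (particleBelief (z j)) (u j) y) ∂(M.ext (w, y))
  set p : ℕ → EuclideanSpace ℝ (Fin n) → ℝ := fun j y =>
    M.density t (particleBelief (z j)) (u j) y
  have hAi : ∀ j, Integrable fun y => p j y * A j y := fun j =>
    integrable_density_mul_of_nextLaw hM (R (φ j)) t w (z j) (u j) (hint _ _ _ _)
  have hDi : ∀ j, Integrable fun y => p j y * D j y := fun j =>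
    ((hM.integrable_kUp t).mul_const B').mono' ((measurable_density hM t _ _).mul
      ((hV.measurable_integral_ext hM t _ (u j)).comp
        measurable_prodMk_left)).aestronglyMeasurable
      (Eventually.of_forall fun y => norm_density_mul_le hM hB' t w _ (u j) y)
  have hdiff : ∀ j, (∫ q, VN (φ j) q.1 q.2 ∂(M.nextLaw (R (φ j)) t w (z j) (u j))) -
      M.nextMean V t w (particleBelief (z j)) (u j) = ∫ y, p j y * (A j y - D j y) := fun j => by
    rw [integral_nextLaw hM (R (φ j)) t w (z j) (u j) (hint _ _ _ _), nextMean,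
      ← integral_sub (hAi j) (hDi j)]
    simp only [mul_sub]
  have hpt : ∀ᵐ y, Tendsto (fun j => p j y * (A j y - D j y)) atTop (𝓝 0) := by
    filter_upwards [ae_all_iff.2 fun j => ae_integrable_of_nextLaw hM (R (φ j)) t w (z j) (u j)
      (hint _ _ _ _) (fun q => hB (φ j) q.1 q.2)] with y hy
    have h := (tendsto_integral_prod_sub hM R hV hB hcmp t w y hφ z hz u hy).norm.const_mul
      (kUp t y)
    rw [norm_zero, mul_zero] at h
    refine squeeze_zero_norm (fun j => ?_) h
    rw [norm_mul, Real.norm_of_nonneg (density_pos hM t _ _ _).le]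
    exact mul_le_mul_of_nonneg_right (density_le_kUp hM t _ _ _) (norm_nonneg _)
  have hlim := tendsto_integral_of_dominated_convergence
    (F := fun j y => p j y * (A j y - D j y)) (f := fun _ => 0) (fun y => kUp t y * (B + B'))
    (fun j => by
      simp only [mul_sub]
      exact ((hAi j).sub (hDi j)).aestronglyMeasurable)
    ((hM.integrable_kUp t).mul_const _) (fun j => Eventually.of_forall fun y => ?_) hpt
  · rw [integral_zero] at hlim
    obtain ⟨j, hj⟩ := (hlim.abs.eventually (gt_mem_nhds (by simpa using hε))).exists
    rw [← hdiff j] at hj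
    exact absurd (hlt j) (not_lt.2 hj.le)
  · rw [norm_mul, Real.norm_of_nonneg (density_pos hM t _ _ _).le]
    exact mul_le_mul (density_le_kUp hM t _ _ _) ((abs_sub _ _).trans
      (add_le_add (abs_integral_le_of_abs_le fun q => hB _ _ _) (abs_integral_ext_le hB' _ _)))
      (norm_nonneg _) (kUp_pos hM t (particleBelief (z j)) (u j) y).le

lemma particleValueToGo_succ [NeZero N] (R : Resampling N) (m t : ℕ) (w : W)
    (z : Particles K X N) :
    M.particleValueToGo R (m + 1) t w z =
      ⨅ u : M.U t, (M.stageCost t w (particleBelief z) u +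
        ∫ q, M.particleValueToGo R m (t + 1) q.1 q.2 ∂(M.nextLaw R t w z u)) := rfl

/-- Independence of `N`, of the rule and of the system lets the bound act as a dominating constant.
Integrability is not needed: the Bochner integral of a bounded function obeys the bound in any case.
-/
lemma exists_abs_particleValueToGo_le [CompactSpace X] (hM : M.Regular kLow kUp) (m t : ℕ) :
    ∃ B : ℝ, ∀ (N : ℕ) (R : Resampling (N + 1)) (w : W) (z : Particles K X (N + 1)),
      |M.particleValueToGo R m t w z| ≤ B := by
  induction m generalizing t with
  | zero => exact ⟨0, fun N R w z => by simp [particleValueToGo]⟩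
  | succ m ih =>
    have : Nonempty (M.U t) := (hM.U_nonempty t).to_subtype
    obtain ⟨B, hB⟩ := ih (t + 1)
    obtain ⟨B₁, h₁⟩ := exists_abs_stageCost_le hM t
    refine ⟨B₁ + B, fun N R w z => ?_⟩
    rw [particleValueToGo_succ]
    refine abs_iInf_le fun u => (abs_add_le _ _).trans (add_le_add (h₁ w _ u) ?_)
    have := isProbabilityMeasure_nextLaw hM R t w z u
    exact abs_integral_le_of_abs_le fun q => hB N R q.1 q.2

/-- The particle values are close to the exact values at the particle beliefs, uniformly over the
particle systems with weights of order `1 / (N + 1)`. -/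
lemma eventually_abs_particleValueToGo_sub_le [CompactSpace X] (hM : M.Regular kLow kUp)
    (R : (N : ℕ) → Resampling (N + 1)) (T t₀ : ℕ)
    (hV : ∀ (N s : ℕ), t₀ ≤ s → s ≤ T → ∀ (w : W) (z : Particles K X (N + 1)) (v : M.U s),
      Integrable (fun q : W × Particles K X (N + 1) => M.particleValue (R N) T (s + 1) q.1 q.2)
        (M.nextLaw (R N) s w z v))
    (m t : ℕ) (ht : t₀ ≤ t) (hm : m + t = T + 1) (w : W) (C ε : ℝ) (hε : 0 < ε) :
    ∀ᶠ N in atTop, ∀ z : Particles K X (N + 1), (∀ i, z.2.1 i ≤ C / (N + 1 : ℕ)) →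
      |M.particleValueToGo (R N) m t w z - M.valueToGo m t w (particleBelief z)| ≤ ε := by
  induction m generalizing t w C ε with
  | zero =>
    refine Eventually.of_forall fun N z _ => ?_
    simpa [particleValueToGo, valueToGo] using hε.le
  | succ m ih =>
    have : Nonempty (M.U t) := (hM.U_nonempty t).to_subtype
    obtain ⟨B, hB⟩ := exists_abs_particleValueToGo_le hM m (t + 1)
    obtain ⟨B₁, h₁⟩ := exists_abs_stageCost_le hM t
    have hreg := regularValue_valueToGo hM m (t + 1)
    obtain ⟨B', hB'⟩ := hreg.bounded
    obtain ⟨B₂, h₂⟩ := exists_abs_nextMean_le hM hB' t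
    have hmT : T + 1 - (t + 1) = m := by omega
    have hint : ∀ N w (z : Particles K X (N + 1)) (u : M.U t),
        Integrable (fun q : W × Particles K X (N + 1) =>
          M.particleValueToGo (R N) m (t + 1) q.1 q.2) (M.nextLaw (R N) t w z u) := by
      intro N w z u
      have := hV N t ht (by omega) w z u
      simpa only [particleValue, hmT] using this
    -- The induction hypothesis is needed for every external input and every weight constant, since
    -- both change in the step.
    filter_upwards [eventually_abs_integral_nextLaw_sub_le hM R hreg
      (VN := fun N => M.particleValueToGo (R N) m (t + 1)) (fun N => hB N (R N))
      (ih (t + 1) (by omega) (by omega)) t hint w C hε] with N hN z hz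
    rw [particleValueToGo_succ, valueToGo_succ]
    refine abs_iInf_sub_iInf_le ⟨-(B₁ + B), ?_⟩ ⟨-(B₁ + B₂), ?_⟩ fun u => ?_
    · rintro _ ⟨u, rfl⟩
      have := isProbabilityMeasure_nextLaw hM (R N) t w z u
      exact (abs_le.1 ((abs_add_le _ _).trans (add_le_add (h₁ w _ u)
        (abs_integral_le_of_abs_le
          fun q : W × Particles K X (N + 1) => hB N (R N) q.1 q.2)))).1
    · rintro _ ⟨u, rfl⟩
      exact (abs_le.1 ((abs_add_le _ _).trans (add_le_add (h₁ w _ u) (h₂ w _ u)))).1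
    · rw [add_sub_add_left_eq_sub]
      exact hN z hz u

end Model

end ParticleBelief

end

/-! ### The convergence theorem -/

theorem mainTheorem4 {n K d : ℕ} {X : Set (EuclideanSpace ℝ (Fin n))}
    {W : Type*} [MeasurableSpace W]
    (M : ParticleBelief.Model n K d X W)
    (kLow kUp : ℕ → EuclideanSpace ℝ (Fin n) → ℝ) (hM : M.Regular kLow kUp)
    -- resampling rule for the filter with `N + 1` particles
    (R : (N : ℕ) → ParticleBelief.Resampling (N + 1))
    -- horizon, time, initial belief, history
    (T t : ℕ) (ht : 1 ≤ t) (htT : t ≤ T)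
    (β₁ : ParticleBelief.Belief K X)
    (w : ℕ → W) (u : (s : ℕ) → M.U s) (y : ℕ → EuclideanSpace ℝ (Fin n))
    -- the expectations in the particle Bellman equation exist
    (hV : ∀ (N s : ℕ), t ≤ s → s ≤ T →
      ∀ (w' : W) (z : ParticleBelief.Particles K X (N + 1)) (v : M.U s),
        MeasureTheory.Integrable
          (fun q : W × ParticleBelief.Particles K X (N + 1) =>
            M.particleValue (R N) T (s + 1) q.1 q.2)
          (M.nextLaw (R N) s w' z v))
    -- for each number of particles, the particle system at time `t` produced by the filter
    {Ω : Type*} [MeasurableSpace Ω] (P : MeasureTheory.Measure Ω)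
    [MeasureTheory.IsProbabilityMeasure P]
    (Z : (N : ℕ) → Ω → ParticleBelief.Particles K X (N + 1))
    (hZ : ∀ N, ProbabilityTheory.HasLaw (Z N) (M.filterLaw (R N) β₁ w u y t) P) :
    ∀ᵐ ω ∂P, Filter.Tendsto (fun N => M.particleValue (R N) T t (w t) (Z N ω)) Filter.atTop
      (nhds (M.value T t (w t) (M.beliefAt β₁ w u y t))) := by
  have : CompactSpace X := isCompact_iff_compactSpace.1 M.isCompact_X
  -- The filter starts at time 1, the entry at time 0 being a dummy, so its laws are indexed by `s +
  -- 1`.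
  obtain ⟨s, rfl⟩ : ∃ s, t = s + 1 := ⟨t - 1, by omega⟩
  obtain ⟨C, hC⟩ := ParticleBelief.Model.exists_ae_forall_weights_le hM R β₁ w u y s hZ
  filter_upwards [ParticleBelief.Model.ae_tendsto_particleBelief hM R β₁ w u y s hZ, hC]
    with ω hω hCω
  have hval := ((ParticleBelief.Model.regularValue_valueToGo hM (T + 1 - (s + 1))
    (s + 1)).continuous (w (s + 1))).tendsto (M.beliefAt β₁ w u y (s + 1))
  have h1 := hval.comp hω
  -- Off one null set the weight bound holds for all `N` at once, so the deterministic uniform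
  -- comparison applies to the realised systems.
  have h2 : Filter.Tendsto (fun N =>
      M.particleValueToGo (R N) (T + 1 - (s + 1)) (s + 1) (w (s + 1)) (Z N ω) -
        M.valueToGo (T + 1 - (s + 1)) (s + 1) (w (s + 1)) (ParticleBelief.particleBelief (Z N ω)))
      Filter.atTop (nhds 0) := by
    rw [Metric.tendsto_atTop']
    intro ε hε
    obtain ⟨J, hJ⟩ := Filter.eventually_atTop.1
      (ParticleBelief.Model.eventually_abs_particleValueToGo_sub_le hM R T (s + 1) hV
        (T + 1 - (s + 1)) (s + 1) le_rfl (by omega) (w (s + 1)) C (ε / 2) (half_pos hε))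
    refine ⟨J, fun N hN => ?_⟩
    rw [Real.dist_eq, sub_zero]
    exact (hJ N hN.le (Z N ω) (hCω N)).trans_lt (half_lt_self hε)
  have h3 := h2.add h1
  simp only [Function.comp_def, sub_add_cancel, zero_add] at h3
  exact h3
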